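/- **Setting.** Let $q_0\ge 1$ and let $d$ be the metric induced by an arbitrary norm on $\mathbb{R}^{q_0}$. For a Borel probability measure $\nu$ on $\mathbb{R}^{q_0}$ with compact support, $n\ge1$ and $s>0$ put $$e_{n,0}(\nu):=\inf_{1\le \mathrm{card}(\alpha)\le n}\exp\int\log d(x,\alpha)\,d\nu(x),\qquad \overline Q_0^s(\nu):=\limsup_{n\to\infty}n^{1/s}e_{n,0}(\nu),\qquad \underline Q_0^s(\nu):=\liminf_{n\to\infty}n^{1/s}e_{n,0}(\nu).$$ Let $P=(p_{ij})_{N\times N}$ be a row-stochastic matrix such that every row of $P$ has at least two positive entries. A finite or infinite word over $\{1,\dots,N\}$ is *admissible* if $p_{ij}>0$ for all consecutive letters $i,j$; let $G_\infty$ be the set of infinite admissible words. For each $(i,j)$ with $p_{ij}>0$ let $c_{ij}\in(0,1)$, and put $c_\sigma:=c_{\sigma_1\sigma_2}\cdots c_{\sigma_{k-1}\sigma_k}$ for an admissible word $\sigma=\sigma_1\cdots\sigma_k$ ($c_\sigma:=1$ if $k=1$). Let $J_1,\dots,J_N\subset\mathbb{R}^{q_0}$ be non-empty compact sets with $J_i=\overline{\mathrm{int}(J_i)}$,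 and for each admissible word $\sigma$ of length $k\ge2$ let $J_\sigma\subset J_{\sigma_1\cdots\sigma_{k-1}}$ be the image of $J_{\sigma_k}$ under a similitude of ratio $c_\sigma$, such that the sets $J_{\sigma j}$ with the same $\sigma$ are non-overlapping (have pairwise disjoint interiors). Assume that there is $t\in(0,1)$ such that for every finite admissible word $\sigma$ (including the empty word) and all letters $j_1\ne j_2$ for which $\sigma j_1,\sigma j_2$ are admissible, $$d(J_{\sigma j_1},J_{\sigma j_2})\ \ge\ t\max\{|J_{\sigma j_1}|,|J_{\sigma j_2}|\},$$ where $|A|$ is the diameter of $A$. Let $(q_i)_{i=1}^N$ be a probability vector with all $q_i>0$, let $\widetilde\mu$ be the Markov measure on $G_\infty$ with $\widetilde\mu(\{\omega\in G_\infty:\omega|_k=\sigma\})=q_{\sigma_1}p_{\sigma_1\sigma_2}\cdots p_{\sigma_{k-1}\sigma_k}$ for every admissible word $\sigma$ of length $k\ge1$, let $g(\omega)$ be the unique point of $\bigcap_{k\ge1}J_{\omega|_k}$ for $\omega\in G_\infty$, and put $\mu:=\widetilde\mu\circ g^{-1}$. Let $\mu_i:=\mu(\,\cdot\,|J_i)$,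 i.e. $\mu_i(B)=\mu(B\cap J_i)/\mu(J_i)$. **Proposition.** Assume that $P$ is irreducible, let $v=(v_1,\dots,v_N)$ be its positive left eigenvector for the eigenvalue $1$ with $\sum_i v_i=1$, and put $$s_0:=\frac{\sum_{i=1}^N v_i\sum_{j:p_{ij}>0}p_{ij}\log p_{ij}}{\sum_{i=1}^N v_i\sum_{j:p_{ij}>0}p_{ij}\log c_{ij}}.$$ Then $s_0>0$, and for every $i\in\{1,\dots,N\}$, $$0<\underline Q_0^{s_0}(\mu_i)\le\overline Q_0^{s_0}(\mu_i)<\infty .$$ -/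

import Mathlib

open MeasureTheory ProbabilityTheory Filter
open scoped ENNReal

namespace GeometricQuantization

/-! ### The geometric mean error -/

section Quantization

variable {V : Type*} [AddCommGroup V] [Module ℝ V]

/-- The distance `d(x, α) = inf_{a ∈ α} d(x, a)` from a point to a finite set, for the metric
induced by a norm `d` on `V`. -/
noncomputable def distToSet (d : Seminorm ℝ V) (x : V) (α : Finset V) : ℝ≥0∞ :=
  ⨅ a ∈ α, ENNReal.ofReal (d (x - a))

/-- The integral `∫ log d(x, α) dν(x)`, as an extended real number: `log 0 = -∞`, and the integral
is the difference of the integrals of the positive and of the negative part. -/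
noncomputable def logIntegral [MeasurableSpace V] (d : Seminorm ℝ V) (ν : Measure V)
    (α : Finset V) : EReal :=
  ((∫⁻ x, (ENNReal.log (distToSet d x α)).toENNReal ∂ν : ℝ≥0∞) : EReal) -
    ((∫⁻ x, (-ENNReal.log (distToSet d x α)).toENNReal ∂ν : ℝ≥0∞) : EReal)

/-- The `n`th geometric mean error
`e_{n,0}(ν) = inf {exp ∫ log d(x, α) dν(x) : 1 ≤ card α ≤ n}`, where `exp (-∞) = 0`. -/
noncomputable def geomMeanError [MeasurableSpace V] (d : Seminorm ℝ V) (ν : Measure V)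
    (n : ℕ) : ℝ≥0∞ :=
  ⨅ (α : Finset V) (_ : 1 ≤ α.card ∧ α.card ≤ n), EReal.exp (logIntegral d ν α)

/-- The `s`-dimensional upper quantization coefficient of order zero. -/
noncomputable def upperQuantCoeff [MeasurableSpace V] (d : Seminorm ℝ V) (s : ℝ)
    (ν : Measure V) : ℝ≥0∞ :=
  limsup (fun n : ℕ => (n : ℝ≥0∞) ^ (1 / s) * geomMeanError d ν n) atTop

/-- The `s`-dimensional lower quantization coefficient of order zero. -/
noncomputable def lowerQuantCoeff [MeasurableSpace V] (d : Seminorm ℝ V) (s : ℝ)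
    (ν : Measure V) : ℝ≥0∞ :=
  liminf (fun n : ℕ => (n : ℝ≥0∞) ^ (1 / s) * geomMeanError d ν n) atTop

end Quantization

/-! ### Words -/

section Words

variable {N : ℕ}

/-- Finite admissible words (the empty word included): consecutive letters `i`, `j` satisfy
`p_{ij} > 0`. -/
def IsWord (P : Matrix (Fin N) (Fin N) ℝ) (σ : List (Fin N)) : Prop :=
  σ.IsChain (fun i j => 0 < P i j)

/-- The product `a_{σ₁σ₂} ⋯ a_{σ_{k-1}σ_k}` along a word (`1` for words of length at most one). -/
def wordProd (a : Matrix (Fin N) (Fin N) ℝ) : List (Fin N) → ℝ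
  | [] => 1
  | [_] => 1
  | i :: j :: l => a i j * wordProd a (j :: l)

/-- The space `G_∞` of infinite admissible words, with the product (Borel) `σ`-algebra. -/
abbrev InfWord (P : Matrix (Fin N) (Fin N) ℝ) : Type :=
  {ω : ℕ → Fin N // ∀ h, 0 < P (ω h) (ω (h + 1))}

/-- The initial word `ω|_k` of length `k` of an infinite word. -/
def initialWord (ω : ℕ → Fin N) (k : ℕ) : List (Fin N) :=
  (List.range k).map ω

/-- `m` is the Markov measure on `G_∞` with initial probability vector `q` and transition
matrix `P`: `m([σ]) = q_{σ₁} p_{σ₁σ₂} ⋯ p_{σ_{k-1}σ_k}` for all nonempty finite words `σ`. -/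
def IsMarkovMeasure (P : Matrix (Fin N) (Fin N) ℝ) (q : Fin N → ℝ)
    (m : Measure (InfWord P)) : Prop :=
  ∀ (i : Fin N) (l : List (Fin N)), IsWord P (i :: l) →
    m {ω | initialWord ω.1 (i :: l).length = i :: l} = ENNReal.ofReal (q i * wordProd P (i :: l))

/-- `v` is the normalized positive left eigenvector of `P` for the eigenvalue `1`. -/
structure IsPerronVector (P : Matrix (Fin N) (Fin N) ℝ) (v : Fin N → ℝ) : Prop where
  pos : ∀ i, 0 < v i
  sum_eq_one : ∑ i, v i = 1
  left_eigen : Matrix.vecMul v P = v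

/-- The exponent `s₀`. -/
noncomputable def exponent (P c : Matrix (Fin N) (Fin N) ℝ) (v : Fin N → ℝ) : ℝ :=
  (∑ i, v i * ∑ j with 0 < P i j, P i j * Real.log (P i j)) /
    (∑ i, v i * ∑ j with 0 < P i j, P i j * Real.log (c i j))

end Words

/-! ### Mauldin-Williams fractals and Markov-type measures -/

section Fractal

variable {N : ℕ} {V : Type*} [NormedAddCommGroup V]

/-- `A` is the image of `B` under a similitude of `V` with ratio `r`. -/
def IsSimilarWithRatio (r : ℝ) (A B : Set V) : Prop :=
  ∃ f : V → V, (∀ x y, dist (f x) (f y) = r * dist x y) ∧ A = f '' B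

/-- `(J σ)`, `σ` a nonempty admissible word, are the cylinders of a Mauldin-Williams fractal with
contraction ratios `c i j`. The values of `J` on other words are irrelevant. -/
structure IsCylinderSystem (P c : Matrix (Fin N) (Fin N) ℝ) (J : List (Fin N) → Set V) :
    Prop where
  ratio_mem : ∀ i j, 0 < P i j → 0 < c i j ∧ c i j < 1
  nonempty : ∀ i, (J [i]).Nonempty
  isCompact : ∀ i, IsCompact (J [i])
  regular : ∀ i, J [i] = closure (interior (J [i]))
  subset : ∀ σ j, σ ≠ [] → IsWord P (σ ++ [j]) → J (σ ++ [j]) ⊆ J σ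
  similar : ∀ σ j, IsWord P (σ ++ [j]) →
    IsSimilarWithRatio (wordProd c (σ ++ [j])) (J (σ ++ [j])) (J [j])
  nonoverlapping : ∀ σ j₁ j₂, σ ≠ [] → j₁ ≠ j₂ → IsWord P (σ ++ [j₁]) → IsWord P (σ ++ [j₂]) →
    Disjoint (interior (J (σ ++ [j₁]))) (interior (J (σ ++ [j₂])))

/-- The separation property: for some `t ∈ (0, 1)`, any two distinct cylinders with the same
predecessor (the empty word included, so that it also concerns cylinders of order one) have
distance at least `t` times the larger one of their diameters. -/
def IsSeparated (P : Matrix (Fin N) (Fin N) ℝ) (J : List (Fin N) → Set V) : Prop :=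
  ∃ t : ℝ, 0 < t ∧ t < 1 ∧ ∀ σ j₁ j₂, j₁ ≠ j₂ → IsWord P (σ ++ [j₁]) → IsWord P (σ ++ [j₂]) →
    ∀ x ∈ J (σ ++ [j₁]), ∀ y ∈ J (σ ++ [j₂]),
      t * max (Metric.diam (J (σ ++ [j₁]))) (Metric.diam (J (σ ++ [j₂]))) ≤ dist x y

/-- The coding map `g : G_∞ → V`; `g ω` is the point of `⋂_{k ≥ 1} J_{ω|_k}`. -/
noncomputable def codingMap (P : Matrix (Fin N) (Fin N) ℝ) (J : List (Fin N) → Set V)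
    (ω : InfWord P) : V :=
  Classical.epsilon fun x => ∀ k, 1 ≤ k → x ∈ J (initialWord ω.1 k)

end Fractal

end GeometricQuantization

/-!
Conditioning `μ` on `J_i` amounts to starting the Markov chain in the letter `i`: the cylinders of
order one are disjoint, so `μ_i` is the image under the coding map of a chain law for which the
cylinder of a word `σ` starting with `i` has probability `p_σ` (`IsMarkovMeasure.isChainLaw`,
`cond_map_codingMap`). Both estimates compare `∫ log d(x, α) dμ_i` with the mean of `log c_{ω|T}`,
where `T` is the level at which the probability `p_{ω|T}` first drops below a threshold `ε` of order
`1/n` (`stopLevel`).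

This mean is computed by optional stopping. The exponent `s₀` is chosen so that
`log p_{ij} - s₀ log c_{ij}` has mean zero for the stationary chain. Since `P` is irreducible, the
range of `1 - P` is the orthogonal complement of the left eigenvector `v`, so the Poisson equation
provides a function `h` of the letters for which
`log p_{ω|k} - s₀ log c_{ω|k} + h(ω_k)` is a martingale
(`exists_martingale_corrector`). Stopping it at `T` gives
`s₀ E log c_{ω|T} = E log p_{ω|T} + O(1) = log ε + O(1)`
(`IsChainLaw.integral_log_pathProd_bounds`).

For the upper estimate, `α` consists of one point in each stopped cylinder. These cylinders are
disjoint and have probability at least `ε · min p_{ij}`, so there are at most `n` of them for a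
suitable `ε ≍ 1/n` (`IsChainLaw.exists_stopped_net`).

For the lower estimate, let `α` have at most `n` points and let `ε = 1/n`. Up to constants,
`-log d(x, α)` exceeds `-log c_{ω|T}` by at most the number of `j` for which `α` comes closer to `x`
than half the separation distance of the cylinder of level `T + j`
(`toENNReal_neg_log_le_tsum`). By the separation condition, for a single point `a` of `α` and a
fixed `j` all the words `ω` for which this happens lie in one cylinder
(`IsCylinderSystem.exists_cylinder_of_close`), whose probability is at most `ε ρ ^ j` with
`ρ = max p_{ij} < 1`. Summation over `a` and `j` gives a total gain of `O(n ε) = O(1)`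
(`IsChainLaw.le_logIntegral`).
-/

namespace GeometricQuantization

/-! ### Products along paths and the cylinder probabilities -/

section Paths

variable {N : ℕ}

/-- The product `a_{x₀x₁} ⋯ a_{x_{k-1}x_k}` along the first `k` steps of a sequence of letters. -/
noncomputable def pathProd (a : Matrix (Fin N) (Fin N) ℝ) (x : ℕ → Fin N) (k : ℕ) : ℝ :=
  ∏ h ∈ Finset.range k, a (x h) (x (h + 1))

/-- The cylinder of the infinite admissible words that agree with `x` up to and including
position `k`. The sequence `x` need not be admissible; if it fails to be so before position `k`,
the cylinder is empty. -/
def pathCylinder (P : Matrix (Fin N) (Fin N) ℝ) (x : ℕ → Fin N) (k : ℕ) : Set (InfWord P) :=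
  {ω | ∀ h ≤ k, ω.1 h = x h}

variable {P a : Matrix (Fin N) (Fin N) ℝ}

@[simp]
lemma pathProd_zero (x : ℕ → Fin N) : pathProd a x 0 = 1 := by simp [pathProd]

lemma pathProd_succ (x : ℕ → Fin N) (k : ℕ) :
    pathProd a x (k + 1) = pathProd a x k * a (x k) (x (k + 1)) := by
  simp [pathProd, Finset.prod_range_succ]

lemma pathProd_congr {x y : ℕ → Fin N} {k : ℕ} (h : ∀ l ≤ k, x l = y l) :
    pathProd a x k = pathProd a y k := by
  refine Finset.prod_congr rfl fun l hl => ?_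
  have hl := Finset.mem_range.1 hl
  rw [h l hl.le, h (l + 1) hl]

lemma initialWord_succ (x : ℕ → Fin N) (k : ℕ) :
    initialWord x (k + 1) = initialWord x k ++ [x k] := by
  simp [initialWord, List.range_succ]

lemma initialWord_succ_eq_cons (x : ℕ → Fin N) (k : ℕ) :
    initialWord x (k + 1) = x 0 :: initialWord (fun h => x (h + 1)) k := by
  simp [initialWord, List.range_succ_eq_map, Function.comp_def]

@[simp]
lemma length_initialWord (x : ℕ → Fin N) (k : ℕ) : (initialWord x k).length = k := by
  simp [initialWord]

lemma initialWord_eq_iff {x y : ℕ → Fin N} {k : ℕ} :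
    initialWord x k = initialWord y k ↔ ∀ h < k, x h = y h := by
  simp [initialWord, List.map_inj_left]

lemma wordProd_initialWord (a : Matrix (Fin N) (Fin N) ℝ) (x : ℕ → Fin N) (k : ℕ) :
    wordProd a (initialWord x (k + 1)) = pathProd a x k := by
  induction k generalizing x with
  | zero => simp [initialWord, wordProd, List.range_succ]
  | succ k ih =>
    have := ih fun h => x (h + 1)
    rw [initialWord_succ_eq_cons] at this
    rw [initialWord_succ_eq_cons, initialWord_succ_eq_cons, wordProd, this, pathProd, pathProd,
      Finset.prod_range_succ', mul_comm]

lemma isWord_initialWord {x : ℕ → Fin N} {k : ℕ} (hx : ∀ h < k, 0 < P (x h) (x (h + 1))) :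
    IsWord P (initialWord x (k + 1)) := by
  induction k generalizing x with
  | zero => simp [initialWord, IsWord, List.range_succ]
  | succ k ih =>
    have := ih (x := fun h => x (h + 1)) fun h hh => hx (h + 1) (by omega)
    rw [initialWord_succ_eq_cons, initialWord_succ_eq_cons]
    rw [initialWord_succ_eq_cons] at this
    exact List.isChain_cons_cons.2 ⟨hx 0 (by omega), this⟩

lemma InfWord.isWord (ω : InfWord P) (k : ℕ) : IsWord P (initialWord ω.1 (k + 1)) :=
  isWord_initialWord fun h _ => ω.2 h

lemma measurable_letter (h : ℕ) : Measurable fun ω : InfWord P => ω.1 h :=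
  (measurable_pi_apply h).comp measurable_subtype_coe

lemma measurableSet_pathCylinder (x : ℕ → Fin N) (k : ℕ) :
    MeasurableSet (pathCylinder P x k) := by
  have : pathCylinder P x k = ⋂ h, ⋂ (_ : h ≤ k), (fun ω : InfWord P => ω.1 h) ⁻¹' {x h} := by
    ext; simp [pathCylinder]
  rw [this]
  exact MeasurableSet.iInter fun h => MeasurableSet.iInter fun _ =>
    measurable_letter h (measurableSet_singleton _)

/-- The cylinder formula in terms of sequences: it persists for inadmissible sequences, where both
sides vanish. -/
lemma IsMarkovMeasure.measure_pathCylinder (hP : ∀ i j, 0 ≤ P i j) {q : Fin N → ℝ}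
    {m : Measure (InfWord P)} (hm : IsMarkovMeasure P q m) (x : ℕ → Fin N) (k : ℕ) :
    m (pathCylinder P x k) = ENNReal.ofReal (q (x 0) * pathProd P x k) := by
  by_cases hx : ∀ h < k, 0 < P (x h) (x (h + 1))
  · have hw := isWord_initialWord hx
    have := hm (x 0) (initialWord (fun h => x (h + 1)) k)
      (by rwa [← initialWord_succ_eq_cons])
    rw [← initialWord_succ_eq_cons, wordProd_initialWord, length_initialWord] at this
    rw [← this]
    congr 1
    ext ω
    simp [pathCylinder, initialWord_eq_iff]
  · push Not at hx
    obtain ⟨h, hk, hh⟩ := hx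
    have h0 : pathProd P x k = 0 :=
      Finset.prod_eq_zero (Finset.mem_range.2 hk) (le_antisymm hh (hP _ _))
    have : pathCylinder P x k = ∅ := by
      refine Set.eq_empty_of_forall_notMem fun ω hω => ?_
      have := ω.2 h
      rw [hω h hk.le, hω (h + 1) hk] at this
      exact absurd this (not_lt.2 hh)
    simp [this, h0]

lemma IsMarkovMeasure.measure_first_letter (hP : ∀ i j, 0 ≤ P i j) {q : Fin N → ℝ}
    {m : Measure (InfWord P)} (hm : IsMarkovMeasure P q m) (i : Fin N) :
    m {ω | ω.1 0 = i} = ENNReal.ofReal (q i) := by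
  have := hm.measure_pathCylinder hP (fun _ => i) 0
  simpa [pathCylinder] using this

/-- `ν` is the law of the Markov chain on the infinite admissible words started in the letter `i`,
given through its values on cylinders. -/
structure IsChainLaw (P : Matrix (Fin N) (Fin N) ℝ) (i : Fin N) (ν : Measure (InfWord P)) :
    Prop where
  isProb : IsProbabilityMeasure ν
  ae_first : ∀ᵐ ω ∂ν, ω.1 0 = i
  cylinder : ∀ x k, x 0 = i → ν (pathCylinder P x k) = ENNReal.ofReal (pathProd P x k)

/-- Conditioning a Markov measure on its first letter gives the chain started in that letter. -/
lemma IsMarkovMeasure.isChainLaw (hP : ∀ i j, 0 ≤ P i j) {q : Fin N → ℝ} (hq : ∀ i, 0 < q i)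
    {m : Measure (InfWord P)} (hm : IsMarkovMeasure P q m) (i : Fin N) :
    IsChainLaw P i (cond m {ω | ω.1 0 = i}) := by
  have hS : MeasurableSet {ω : InfWord P | ω.1 0 = i} :=
    measurable_letter 0 (measurableSet_singleton i)
  have h1 := hm.measure_first_letter hP i
  have h0 : m {ω | ω.1 0 = i} ≠ 0 := by simp [h1, hq i]
  have ht : m {ω | ω.1 0 = i} ≠ ∞ := by simp [h1]
  refine ⟨cond_isProbabilityMeasure_of_finite h0 ht, ?_, fun x k hx => ?_⟩
  · exact ae_cond_mem hS
  · have hsub : {ω : InfWord P | ω.1 0 = i} ∩ pathCylinder P x k = pathCylinder P x k :=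
      Set.inter_eq_right.2 fun ω hω => (hω 0 (Nat.zero_le _)).trans hx
    rw [cond_apply hS, hsub, hm.measure_pathCylinder hP, h1, hx, ENNReal.ofReal_mul (hq i).le,
      ← mul_assoc, ENNReal.inv_mul_cancel (by simp [hq i]) (by simp), one_mul]

end Paths

/-! ### Stopping levels and optional stopping -/

section Stopping

variable {N : ℕ} {P : Matrix (Fin N) (Fin N) ℝ}

lemma pathProd_nonneg (hP : ∀ i j, 0 ≤ P i j) (x : ℕ → Fin N) (k : ℕ) : 0 ≤ pathProd P x k :=
  Finset.prod_nonneg fun _ _ => hP _ _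

/-- A product along an admissible word is positive if the factors are positive on admissible
pairs. -/
lemma pathProd_pos {a : Matrix (Fin N) (Fin N) ℝ} (ha : ∀ i j, 0 < P i j → 0 < a i j)
    (ω : InfWord P) (k : ℕ) : 0 < pathProd a ω.1 k :=
  Finset.prod_pos fun h _ => ha _ _ (ω.2 h)

lemma log_pathProd {a : Matrix (Fin N) (Fin N) ℝ} (ha : ∀ i j, 0 < P i j → 0 < a i j)
    (ω : InfWord P) (k : ℕ) :
    Real.log (pathProd a ω.1 k) = ∑ h ∈ Finset.range k, Real.log (a (ω.1 h) (ω.1 (h + 1))) :=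
  Real.log_prod fun h _ => (ha _ _ (ω.2 h)).ne'

lemma pathProd_add_le {ρ : ℝ} (hP : ∀ i j, 0 ≤ P i j) (hρ : ∀ i j, P i j ≤ ρ)
    (x : ℕ → Fin N) (k j : ℕ) : pathProd P x (k + j) ≤ pathProd P x k * ρ ^ j := by
  induction j with
  | zero => simp
  | succ j ih =>
    rw [← add_assoc, pathProd_succ, pow_succ, ← mul_assoc]
    exact mul_le_mul ih (hρ _ _) (hP _ _) ((pathProd_nonneg hP _ _).trans ih)

lemma pathProd_antitone {ρ : ℝ} (hP : ∀ i j, 0 ≤ P i j) (hρ : ∀ i j, P i j ≤ ρ) (hρ1 : ρ < 1)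
    (x : ℕ → Fin N) : Antitone (pathProd P x) := by
  refine antitone_nat_of_succ_le fun k => ?_
  rw [pathProd_succ]
  exact mul_le_of_le_one_right (pathProd_nonneg hP _ _) ((hρ _ _).trans hρ1.le)

/-- The first level at which the cylinder probability of the sequence `x` drops below `ε`. -/
noncomputable def stopLevel (P : Matrix (Fin N) (Fin N) ℝ) (ε : ℝ) (x : ℕ → Fin N) : ℕ :=
  sInf {k | pathProd P x k < ε}

variable {ρ ε : ℝ}

/-- The stopping level is bounded, uniformly over all sequences. -/
lemma exists_stopLevel_le (hP : ∀ i j, 0 ≤ P i j) (hρ : ∀ i j, P i j ≤ ρ) (hρ1 : ρ < 1)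
    (hε : 0 < ε) :
    ∃ K : ℕ, ∀ x : ℕ → Fin N, pathProd P x (stopLevel P ε x) < ε ∧ stopLevel P ε x ≤ K := by
  obtain ⟨K, hK⟩ := exists_pow_lt_of_lt_one hε hρ1
  refine ⟨K, fun x => ?_⟩
  have hmem : K ∈ {k | pathProd P x k < ε} := by
    have := pathProd_add_le hP hρ x 0 K
    simp only [zero_add, pathProd_zero, one_mul] at this
    exact this.trans_lt hK
  exact ⟨Nat.sInf_mem (s := {k | pathProd P x k < ε}) ⟨K, hmem⟩, Nat.sInf_le hmem⟩

lemma lt_stopLevel_iff (hP : ∀ i j, 0 ≤ P i j) (hρ : ∀ i j, P i j ≤ ρ) (hρ1 : ρ < 1)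
    (hε : 0 < ε) {x : ℕ → Fin N} {k : ℕ} :
    k < stopLevel P ε x ↔ ε ≤ pathProd P x k := by
  constructor
  · intro h
    exact not_lt.1 (Nat.notMem_of_lt_sInf (s := {k | pathProd P x k < ε}) h)
  · intro h
    by_contra hk
    obtain ⟨K, hK⟩ := exists_stopLevel_le hP hρ hρ1 hε
    exact absurd ((pathProd_antitone hP hρ hρ1 x (not_lt.1 hk)).trans_lt (hK x).1) (not_lt.2 h)

/-- The stopping level is determined by the letters up to that level. -/
lemma stopLevel_eq (hP : ∀ i j, 0 ≤ P i j) (hρ : ∀ i j, P i j ≤ ρ) (hρ1 : ρ < 1)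
    (hε : 0 < ε) {x y : ℕ → Fin N} (h : ∀ l ≤ stopLevel P ε x, y l = x l) :
    stopLevel P ε y = stopLevel P ε x := by
  obtain ⟨K, hK⟩ := exists_stopLevel_le hP hρ hρ1 hε
  refine eq_of_forall_lt_iff fun k => ?_
  rcases le_or_gt k (stopLevel P ε x) with hk | hk
  · rw [lt_stopLevel_iff hP hρ hρ1 hε, lt_stopLevel_iff hP hρ hρ1 hε,
      pathProd_congr fun l hl => h l (hl.trans hk)]
  · refine ⟨fun h' => ?_, fun h' => absurd h' (not_lt.2 hk.le)⟩
    have h1 := (lt_stopLevel_iff hP hρ hρ1 hε).1 (hk.trans h')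
    rw [pathProd_congr h] at h1
    exact absurd (hK x).1 (not_lt.2 h1)

lemma stopLevel_pos (hP : ∀ i j, 0 ≤ P i j) (hρ : ∀ i j, P i j ≤ ρ) (hρ1 : ρ < 1)
    (hε : 0 < ε) (hε1 : ε ≤ 1) (x : ℕ → Fin N) : 0 < stopLevel P ε x :=
  (lt_stopLevel_iff hP hρ hρ1 hε).2 (by simpa using hε1)

lemma mul_le_pathProd_stopLevel (hP : ∀ i j, 0 ≤ P i j) (hρ : ∀ i j, P i j ≤ ρ) (hρ1 : ρ < 1)
    (hε : 0 < ε) (hε1 : ε ≤ 1) {δ : ℝ} (hδ0 : 0 ≤ δ)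
    (hδ : ∀ i j, 0 < P i j → δ ≤ P i j)
    (ω : InfWord P) : ε * δ ≤ pathProd P ω.1 (stopLevel P ε ω.1) := by
  have hpos := stopLevel_pos hP hρ hρ1 hε hε1 ω.1
  obtain ⟨k, hk⟩ := Nat.exists_eq_succ_of_ne_zero hpos.ne'
  have h1 := (lt_stopLevel_iff hP hρ hρ1 hε).1 (hk ▸ Nat.lt_succ_self k)
  rw [hk, Nat.succ_eq_add_one, pathProd_succ]
  exact mul_le_mul h1 (hδ _ _ (ω.2 k)) hδ0 (hε.le.trans h1)

/-- A function of the first `k + 1` letters takes finitely many values, hence is measurable and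
integrable. -/
lemma measurable_integrable_of_letters {f : InfWord P → ℝ} {k : ℕ}
    (hf : ∀ ω ω' : InfWord P, (∀ h ≤ k, ω.1 h = ω'.1 h) → f ω = f ω')
    (ν : Measure (InfWord P)) [IsFiniteMeasure ν] : Measurable f ∧ Integrable f ν := by
  let π : InfWord P → (Fin (k + 1) → Fin N) := fun ω h => ω.1 h
  have hπ : Measurable π := measurable_pi_lambda _ fun h => measurable_letter _
  have hfac : Function.FactorsThrough f π := fun ω ω' h =>
    hf ω ω' fun l hl => congrFun h ⟨l, Nat.lt_succ_of_le hl⟩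
  have he : f = Function.extend π f (fun _ => 0) ∘ π := (hfac.extend_comp (fun _ => 0)).symm
  rw [he]
  exact ⟨(measurable_of_finite _).comp hπ,
    (Integrable.of_finite (μ := ν.map π)).comp_measurable hπ⟩

/-- If `u` has mean zero under every row of `P`, then the increment `u (ω_k) (ω_{k+1})` is
orthogonal to every function `φ` of the first `k + 1` letters. -/
lemma IsChainLaw.integral_step (hP : ∀ i j, 0 ≤ P i j) {i : Fin N} {ν : Measure (InfWord P)}
    (hν : IsChainLaw P i ν) {u : Fin N → Fin N → ℝ} (hu : ∀ a, ∑ b, P a b * u a b = 0) {k : ℕ}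
    {φ : (ℕ → Fin N) → ℝ} (hφ : ∀ x y : ℕ → Fin N, (∀ h ≤ k, x h = y h) → φ x = φ y) :
    ∫ ω : InfWord P, φ ω.1 * u (ω.1 k) (ω.1 (k + 1)) ∂ν = 0 := by
  have := hν.isProb
  let X : (Fin (k + 1) → Fin N) × Fin N → ℕ → Fin N := fun w h =>
    if hh : h < k + 1 then w.1 ⟨h, hh⟩ else w.2
  have hX1 : ∀ w, X w (k + 1) = w.2 := fun w => by simp [X]
  have hXk : ∀ w h (hh : h < k + 1), X w h = w.1 ⟨h, hh⟩ := fun w h hh => dif_pos hh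
  let F : (ℕ → Fin N) → ℝ := fun x => φ x * u (x k) (x (k + 1))
  have hF : ∀ x y : ℕ → Fin N, (∀ h ≤ k + 1, x h = y h) → F x = F y := fun x y h => by
    simp only [F]
    rw [hφ x y fun l hl => h l (by omega), h k (by omega), h (k + 1) le_rfl]
  have hint : Integrable (fun ω : InfWord P => F ω.1) ν :=
    (measurable_integrable_of_letters (k := k + 1) (fun ω ω' h => hF _ _ h) ν).2
  have hcover : (⋃ w, pathCylinder P (X w) (k + 1)) = Set.univ := by
    refine Set.eq_univ_of_forall fun ω => Set.mem_iUnion.2 ⟨(fun h => ω.1 h, ω.1 (k + 1)), ?_⟩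
    intro h hh
    rcases Nat.lt_or_ge h (k + 1) with h1 | h1
    · rw [hXk _ _ h1]
    · obtain rfl : h = k + 1 := le_antisymm hh h1
      rw [hX1]
  have hdisj : Pairwise (Function.onFun Disjoint fun w => pathCylinder P (X w) (k + 1)) := by
    intro w w' hne
    refine Set.disjoint_left.2 fun ω h1 h2 => hne ?_
    have h3 : ∀ h ≤ k + 1, X w h = X w' h := fun h hh => (h1 h hh).symm.trans (h2 h hh)
    refine Prod.ext (funext fun h => ?_) ?_
    · simpa only [hXk _ _ h.2] using h3 h (by omega)
    · simpa only [hX1] using h3 (k + 1) le_rfl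
  have hpiece : ∀ w, ∫ ω in pathCylinder P (X w) (k + 1), F ω.1 ∂ν =
      ν.real (pathCylinder P (X w) (k + 1)) * F (X w) := fun w => by
    rw [setIntegral_congr_fun (g := fun _ => F (X w)) (measurableSet_pathCylinder _ _)
      fun ω hω => hF _ _ hω, setIntegral_const, smul_eq_mul]
  have htot : ∫ ω : InfWord P, F ω.1 ∂ν =
      ∑ w, ν.real (pathCylinder P (X w) (k + 1)) * F (X w) := by
    rw [← setIntegral_univ, ← hcover,
      integral_iUnion_fintype (fun w => measurableSet_pathCylinder _ _) hdisj
        fun w => hint.integrableOn]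
    exact Finset.sum_congr rfl fun w _ => hpiece w
  refine htot.trans ?_
  rw [Fintype.sum_prod_type]
  refine Finset.sum_eq_zero fun w _ => ?_
  by_cases hw : w 0 = i
  · have hterm : ∀ b, ν.real (pathCylinder P (X (w, b)) (k + 1)) * F (X (w, b)) =
        pathProd P (X (w, w 0)) k * φ (X (w, w 0)) *
          (P (w (Fin.last k)) b * u (w (Fin.last k)) b) := fun b => by
      have hk : X (w, b) k = w (Fin.last k) := hXk _ _ (Nat.lt_succ_self k)
      have hc : ∀ h ≤ k, X (w, b) h = X (w, w 0) h := fun h hh => by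
        rw [hXk _ _ (Nat.lt_succ_of_le hh), hXk _ _ (Nat.lt_succ_of_le hh)]
      rw [Measure.real, hν.cylinder _ _ ((hXk _ _ (Nat.succ_pos k)).trans hw),
        ENNReal.toReal_ofReal (pathProd_nonneg hP _ _), pathProd_succ, pathProd_congr hc]
      simp only [F]
      rw [hφ _ _ hc, hX1, hk]
      ring
    simp only [hterm]
    rw [← Finset.mul_sum, hu, mul_zero]
  · refine Finset.sum_eq_zero fun b _ => ?_
    have h0 : ν (pathCylinder P (X (w, b)) (k + 1)) = 0 := by
      refine measure_mono_null (fun ω hω => ?_) (ae_iff.1 hν.ae_first)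
      have := (hω 0 (Nat.zero_le _)).trans (hXk _ _ (Nat.succ_pos k))
      change ¬ ω.1 0 = i
      rw [this]
      exact hw
    simp [Measure.real, h0]

/-- Functions of the word up to its stopping level are measurable and integrable. -/
lemma measurable_integrable_stopped (hP : ∀ i j, 0 ≤ P i j) (hρ : ∀ i j, P i j ≤ ρ) (hρ1 : ρ < 1)
    (hε : 0 < ε) (ν : Measure (InfWord P)) [IsFiniteMeasure ν]
    {f : ℕ → (ℕ → Fin N) → ℝ}
    (hf : ∀ k (x y : ℕ → Fin N), (∀ h ≤ k, x h = y h) → f k x = f k y) :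
    Measurable (fun ω : InfWord P => f (stopLevel P ε ω.1) ω.1) ∧
      Integrable (fun ω : InfWord P => f (stopLevel P ε ω.1) ω.1) ν := by
  obtain ⟨K, hK⟩ := exists_stopLevel_le hP hρ hρ1 hε
  refine measurable_integrable_of_letters (k := K) (fun ω ω' h => ?_) ν
  have h1 : stopLevel P ε ω'.1 = stopLevel P ε ω.1 :=
    stopLevel_eq hP hρ hρ1 hε fun l hl => (h l (hl.trans (hK _).2)).symm
  rw [h1]
  exact hf _ _ _ fun l hl => h l (hl.trans (hK _).2)

/-- Optional stopping: the sum of mean zero increments up to the stopping level has mean zero. -/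
lemma IsChainLaw.integral_sum_stopLevel (hP : ∀ i j, 0 ≤ P i j) (hρ : ∀ i j, P i j ≤ ρ)
    (hρ1 : ρ < 1) (hε : 0 < ε) {i : Fin N} {ν : Measure (InfWord P)}
    (hν : IsChainLaw P i ν) {u : Fin N → Fin N → ℝ} (hu : ∀ a, ∑ b, P a b * u a b = 0) :
    ∫ ω : InfWord P, ∑ k ∈ Finset.range (stopLevel P ε ω.1), u (ω.1 k) (ω.1 (k + 1)) ∂ν = 0 := by
  classical
  have := hν.isProb
  obtain ⟨K, hK⟩ := exists_stopLevel_le hP hρ hρ1 hε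
  let φ : ℕ → (ℕ → Fin N) → ℝ := fun k x => if ε ≤ pathProd P x k then 1 else 0
  have hφ : ∀ k (x y : ℕ → Fin N), (∀ h ≤ k, x h = y h) → φ k x = φ k y := fun k x y h => by
    simp only [φ, pathProd_congr h]
  have heq : ∀ ω : InfWord P, ∑ k ∈ Finset.range (stopLevel P ε ω.1), u (ω.1 k) (ω.1 (k + 1)) =
      ∑ k ∈ Finset.range K, φ k ω.1 * u (ω.1 k) (ω.1 (k + 1)) := fun ω => by
    have hsub : Finset.range (stopLevel P ε ω.1) =
        (Finset.range K).filter fun k => ε ≤ pathProd P ω.1 k := by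
      ext k
      simp only [Finset.mem_range, Finset.mem_filter, ← lt_stopLevel_iff hP hρ hρ1 hε]
      exact ⟨fun h => ⟨h.trans_le (hK _).2, h⟩, fun h => h.2⟩
    rw [hsub, Finset.sum_filter]
    exact Finset.sum_congr rfl fun k _ => by simp [φ, ite_mul]
  simp only [heq]
  rw [integral_finsetSum]
  · exact Finset.sum_eq_zero fun k _ => hν.integral_step hP hu (hφ k)
  · intro k _
    refine (measurable_integrable_of_letters (k := k + 1) (fun ω ω' h => ?_) ν).2
    rw [hφ k ω.1 ω'.1 fun l hl => h l (by omega), h k (by omega), h (k + 1) le_rfl]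

end Stopping

/-! ### Geometry of the cylinders and the coding map -/

section Geometry

open Topology

lemma exists_lt_one_forall_le {ι : Type*} [Finite ι] {p : ι → Prop} {f : ι → ℝ}
    (h : ∀ i, p i → f i < 1) : ∃ r, 0 < r ∧ r < 1 ∧ ∀ i, p i → f i ≤ r := by
  have h1 : ∀ᶠ r in 𝓝[<] (1 : ℝ), ∀ i, p i → f i ≤ r := by
    refine eventually_all.2 fun i => ?_
    by_cases hi : p i
    · filter_upwards [Ioo_mem_nhdsLT (h i hi)] with r hr _ using hr.1.le
    · exact Eventually.of_forall fun r h' => absurd h' hi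
  obtain ⟨r, hr, hr'⟩ := (h1.and (Ioo_mem_nhdsLT (zero_lt_one' ℝ))).exists
  exact ⟨r, hr'.1, hr'.2, hr⟩

lemma exists_pos_forall_le {ι : Type*} [Finite ι] {p : ι → Prop} {f : ι → ℝ}
    (h : ∀ i, p i → 0 < f i) : ∃ r, 0 < r ∧ r < 1 ∧ ∀ i, p i → r ≤ f i := by
  obtain ⟨r, h0, h1, hr⟩ := exists_lt_one_forall_le (p := p) (f := fun i => 1 - f i)
    fun i hi => by linarith [h i hi]
  exact ⟨1 - r, by linarith, by linarith, fun i hi => by linarith [hr i hi]⟩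

variable {N : ℕ} {V : Type*} {P c : Matrix (Fin N) (Fin N) ℝ}
  {J : List (Fin N) → Set V}

/-- The cylinder `J_{ω|_{k+1}}` of an infinite word. -/
def levelSet (J : List (Fin N) → Set V) (ω : InfWord P) (k : ℕ) : Set V :=
  J (initialWord ω.1 (k + 1))

lemma levelSet_congr {ω ω' : InfWord P} {k : ℕ} (h : ∀ l ≤ k, ω.1 l = ω'.1 l) :
    levelSet J ω k = levelSet J ω' k :=
  congrArg J (initialWord_eq_iff.2 fun l hl => h l (Nat.le_of_lt_succ hl))

variable [NormedAddCommGroup V]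

lemma IsSimilarWithRatio.isCompact {r : ℝ} {A B : Set V} (hr : 0 ≤ r)
    (h : IsSimilarWithRatio r A B) (hB : IsCompact B) : IsCompact A := by
  obtain ⟨f, hf, rfl⟩ := h
  exact hB.image (LipschitzWith.of_dist_le_mul (K := ⟨r, hr⟩) fun x y => (hf x y).le).continuous

lemma IsSimilarWithRatio.diam_eq {r : ℝ} {A B : Set V} (hr : 0 < r)
    (h : IsSimilarWithRatio r A B) (hB : IsCompact B) :
    Metric.diam A = r * Metric.diam B := by
  have hA := h.isCompact hr.le hB
  obtain ⟨f, hf, rfl⟩ := h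
  refine le_antisymm (Metric.diam_le_of_forall_dist_le (by positivity) ?_) ?_
  · rintro _ ⟨x, hx, rfl⟩ _ ⟨y, hy, rfl⟩
    rw [hf]
    exact mul_le_mul_of_nonneg_left (Metric.dist_le_diam_of_mem hB.isBounded hx hy) hr.le
  · rw [mul_comm, ← le_div_iff₀ hr]
    refine Metric.diam_le_of_forall_dist_le (by positivity) fun x hx y hy => ?_
    rw [le_div_iff₀ hr, mul_comm, ← hf]
    exact Metric.dist_le_diam_of_mem hA.isBounded (Set.mem_image_of_mem f hx)
      (Set.mem_image_of_mem f hy)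


lemma IsCylinderSystem.pathProd_pos (hJ : IsCylinderSystem P c J) (ω : InfWord P) (k : ℕ) :
    0 < pathProd c ω.1 k :=
  GeometricQuantization.pathProd_pos (fun i j h => (hJ.ratio_mem i j h).1) ω k

lemma IsCylinderSystem.similar_levelSet (hJ : IsCylinderSystem P c J) (ω : InfWord P) (k : ℕ) :
    IsSimilarWithRatio (pathProd c ω.1 k) (levelSet J ω k) (J [ω.1 k]) := by
  have := hJ.similar (initialWord ω.1 k) (ω.1 k) (by
    rw [← initialWord_succ]; exact ω.isWord k)
  rwa [← initialWord_succ, wordProd_initialWord] at this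

lemma IsCylinderSystem.isCompact_levelSet (hJ : IsCylinderSystem P c J) (ω : InfWord P) (k : ℕ) :
    IsCompact (levelSet J ω k) :=
  (hJ.similar_levelSet ω k).isCompact (hJ.pathProd_pos ω k).le (hJ.isCompact _)

lemma IsCylinderSystem.diam_levelSet (hJ : IsCylinderSystem P c J) (ω : InfWord P) (k : ℕ) :
    Metric.diam (levelSet J ω k) = pathProd c ω.1 k * Metric.diam (J [ω.1 k]) :=
  (hJ.similar_levelSet ω k).diam_eq (hJ.pathProd_pos ω k) (hJ.isCompact _)

lemma IsCylinderSystem.nonempty_levelSet (hJ : IsCylinderSystem P c J) (ω : InfWord P) (k : ℕ) :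
    (levelSet J ω k).Nonempty := by
  obtain ⟨f, -, hf⟩ := hJ.similar_levelSet ω k
  rw [hf]
  exact (hJ.nonempty _).image f

lemma IsCylinderSystem.antitone_levelSet (hJ : IsCylinderSystem P c J) (ω : InfWord P) :
    Antitone (levelSet J ω) := by
  refine antitone_nat_of_succ_le fun k => ?_
  have := hJ.subset (initialWord ω.1 (k + 1)) (ω.1 (k + 1)) (by simp [initialWord_succ])
    (by rw [← initialWord_succ]; exact ω.isWord _)
  rwa [← initialWord_succ] at this

lemma IsCylinderSystem.codingMap_mem (hJ : IsCylinderSystem P c J) (ω : InfWord P) (k : ℕ) :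
    codingMap P J ω ∈ levelSet J ω k := by
  obtain ⟨x, hx⟩ := IsCompact.nonempty_iInter_of_sequence_nonempty_isCompact_isClosed
    (levelSet J ω) (fun k => hJ.antitone_levelSet ω k.le_succ) (hJ.nonempty_levelSet ω)
    (hJ.isCompact_levelSet ω 0) fun k => (hJ.isCompact_levelSet ω k).isClosed
  have hex : ∃ x, ∀ k, 1 ≤ k → x ∈ J (initialWord ω.1 k) := by
    refine ⟨x, fun k hk => ?_⟩
    obtain ⟨l, rfl⟩ := Nat.exists_eq_add_of_le' hk
    exact Set.mem_iInter.1 hx l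
  exact Classical.epsilon_spec hex (k + 1) (Nat.le_add_left 1 k)

lemma IsCylinderSystem.tendsto_diam_levelSet (hJ : IsCylinderSystem P c J) (ω : InfWord P) :
    Tendsto (fun k => Metric.diam (levelSet J ω k)) atTop (𝓝 0) := by
  obtain ⟨r, h0, h1, hr⟩ := exists_lt_one_forall_le (p := fun s : Fin N × Fin N => 0 < P s.1 s.2)
    (f := fun s => c s.1 s.2) fun s hs => (hJ.ratio_mem _ _ hs).2
  have hle : ∀ k, Metric.diam (levelSet J ω k) ≤ r ^ k * ∑ j, Metric.diam (J [j]) := fun k => by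
    rw [hJ.diam_levelSet]
    refine mul_le_mul ?_ (Finset.single_le_sum (f := fun j => Metric.diam (J [j]))
      (fun _ _ => Metric.diam_nonneg) (Finset.mem_univ _)) Metric.diam_nonneg (by positivity)
    calc pathProd c ω.1 k ≤ ∏ _h ∈ Finset.range k, r :=
          Finset.prod_le_prod (fun h _ => (hJ.ratio_mem _ _ (ω.2 h)).1.le)
            fun h _ => hr (ω.1 h, ω.1 (h + 1)) (ω.2 h)
      _ = r ^ k := by simp
  refine squeeze_zero (fun _ => Metric.diam_nonneg) hle ?_
  simpa using (tendsto_pow_atTop_nhds_zero_of_lt_one h0.le h1).mul_const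
    (∑ j, Metric.diam (J [j]))

/-- The coding map is the pointwise limit of maps that depend on finitely many letters. -/
lemma IsCylinderSystem.measurable_codingMap [MeasurableSpace V] [BorelSpace V]
    (hJ : IsCylinderSystem P c J) : Measurable (codingMap P J) := by
  classical
  let y : ℕ → InfWord P → V := fun k ω => Classical.epsilon (· ∈ levelSet J ω k)
  have hy : ∀ k ω, y k ω ∈ levelSet J ω k := fun k ω =>
    Classical.epsilon_spec (hJ.nonempty_levelSet ω k)
  refine measurable_of_tendsto_metrizable (f := y) (fun k => ?_) (tendsto_pi_nhds.2 fun ω => ?_)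
  · let π : InfWord P → (Fin (k + 1) → Fin N) := fun ω h => ω.1 h
    have hπ : Measurable π := measurable_pi_lambda _ fun h => measurable_letter _
    have hfac : Function.FactorsThrough (y k) π := fun ω ω' h => by
      simp only [y]
      rw [levelSet_congr fun l hl => congrFun h ⟨l, Nat.lt_succ_of_le hl⟩]
    rw [← hfac.extend_comp fun _ => 0]
    exact (measurable_of_finite _).comp hπ
  · refine tendsto_iff_dist_tendsto_zero.2 (squeeze_zero (fun _ => dist_nonneg) (fun k => ?_)
      (hJ.tendsto_diam_levelSet ω))
    exact Metric.dist_le_diam_of_mem (hJ.isCompact_levelSet ω k).isBounded (hy k ω)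
      (hJ.codingMap_mem ω k)

lemma IsCylinderSystem.diam_pos [NormedSpace ℝ V] [Nontrivial V] (hJ : IsCylinderSystem P c J)
    (i : Fin N) : 0 < Metric.diam (J [i]) := by
  by_contra h
  have hsub : (J [i]).Subsingleton := by
    by_contra hs
    exact h (Metric.diam_pos (Set.not_subsingleton_iff.1 hs) (hJ.isCompact i).isBounded)
  obtain ⟨x, hx⟩ := hJ.nonempty i
  have h1 : J [i] = {x} := hsub.eq_singleton_of_mem hx
  have := Module.punctured_nhds_neBot ℝ V x
  have h2 := hJ.regular i
  rw [h1, interior_singleton, closure_empty] at h2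
  exact Set.singleton_ne_empty x h2

/-- Two words that differ at some position have images that are separated by a definite proportion
of the diameters of all later cylinders around them. -/
lemma IsCylinderSystem.le_dist_codingMap (hJ : IsCylinderSystem P c J) {t : ℝ} (ht : 0 ≤ t)
    (hsep : ∀ σ j₁ j₂, j₁ ≠ j₂ → IsWord P (σ ++ [j₁]) → IsWord P (σ ++ [j₂]) →
      ∀ x ∈ J (σ ++ [j₁]), ∀ y ∈ J (σ ++ [j₂]),
        t * max (Metric.diam (J (σ ++ [j₁]))) (Metric.diam (J (σ ++ [j₂]))) ≤ dist x y)
    {ω ω' : InfWord P} {k k' : ℕ} (h : ∃ l, l ≤ k ∧ l ≤ k' ∧ ω.1 l ≠ ω'.1 l) :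
    t * max (Metric.diam (levelSet J ω k)) (Metric.diam (levelSet J ω' k')) ≤
      dist (codingMap P J ω) (codingMap P J ω') := by
  classical
  obtain ⟨hk, hk', hne⟩ := Nat.find_spec h
  set l := Nat.find h
  have hbelow : initialWord ω'.1 l = initialWord ω.1 l := initialWord_eq_iff.2 fun b hb => by
    by_contra hb'
    exact Nat.find_min h hb ⟨hb.le.trans hk, hb.le.trans hk', fun e => hb' e.symm⟩
  have e : levelSet J ω l = J (initialWord ω.1 l ++ [ω.1 l]) :=
    congrArg J (initialWord_succ _ _)
  have e' : levelSet J ω' l = J (initialWord ω.1 l ++ [ω'.1 l]) :=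
    congrArg J (by rw [initialWord_succ, hbelow])
  have hw := ω.isWord l
  have hw' := ω'.isWord l
  rw [initialWord_succ] at hw hw'
  rw [hbelow] at hw'
  have := hsep _ _ _ hne hw hw' _ (e ▸ hJ.codingMap_mem ω l) _ (e' ▸ hJ.codingMap_mem ω' l)
  rw [← e, ← e'] at this
  refine le_trans (mul_le_mul_of_nonneg_left (max_le_max ?_ ?_) ht) this
  · exact Metric.diam_mono (hJ.antitone_levelSet ω hk) (hJ.isCompact_levelSet ω l).isBounded
  · exact Metric.diam_mono (hJ.antitone_levelSet ω' hk') (hJ.isCompact_levelSet ω' l).isBounded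

/-- Whatever levels `τ ω` are chosen, the words `ω` whose image is close to a given point, relative
to the size of the level `τ ω` cylinder around `ω`, all lie in one of these cylinders. -/
lemma IsCylinderSystem.exists_cylinder_of_close (hJ : IsCylinderSystem P c J) {t : ℝ} (ht : 0 ≤ t)
    (hsep : ∀ σ j₁ j₂, j₁ ≠ j₂ → IsWord P (σ ++ [j₁]) → IsWord P (σ ++ [j₂]) →
      ∀ x ∈ J (σ ++ [j₁]), ∀ y ∈ J (σ ++ [j₂]),
        t * max (Metric.diam (J (σ ++ [j₁]))) (Metric.diam (J (σ ++ [j₂]))) ≤ dist x y)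
    (τ : InfWord P → ℕ) (a : V) {S : Set (InfWord P)}
    (hS : ∀ ω ∈ S, dist (codingMap P J ω) a < t / 2 * Metric.diam (levelSet J ω (τ ω)))
    (hne : S.Nonempty) : ∃ ω ∈ S, S ⊆ pathCylinder P ω.1 (τ ω) := by
  obtain ⟨ω, hω, hmin⟩ := exists_minimalFor_of_wellFoundedLT (· ∈ S) τ hne
  have hmin : ∀ ω' ∈ S, τ ω ≤ τ ω' := fun ω' h' => by
    rcases le_total (τ ω) (τ ω') with h | h
    · exact h
    · exact hmin h' h
  refine ⟨ω, hω, fun ω' hω' h hh => ?_⟩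
  by_contra hdiff
  have h1 := hJ.le_dist_codingMap ht hsep (ω := ω) (ω' := ω') (k := τ ω) (k' := τ ω')
    ⟨h, hh, hh.trans (hmin ω' hω'), fun e => hdiff e.symm⟩
  have h2 := dist_triangle_right (codingMap P J ω) (codingMap P J ω') a
  have h3 := hS ω hω
  have h4 := hS ω' hω'
  have h5 := mul_le_mul_of_nonneg_left
    (le_max_left (Metric.diam (levelSet J ω (τ ω))) (Metric.diam (levelSet J ω' (τ ω')))) ht
  have h6 := mul_le_mul_of_nonneg_left
    (le_max_right (Metric.diam (levelSet J ω (τ ω))) (Metric.diam (levelSet J ω' (τ ω')))) ht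
  linarith

lemma IsCylinderSystem.codingMap_preimage [NormedSpace ℝ V] [Nontrivial V]
    (hJ : IsCylinderSystem P c J) (hsep : IsSeparated P J) (i : Fin N) :
    codingMap P J ⁻¹' (J [i]) = {ω | ω.1 0 = i} := by
  obtain ⟨t, ht0, -, hsep⟩ := hsep
  have h0 : ∀ ω : InfWord P, codingMap P J ω ∈ J [ω.1 0] := fun ω => hJ.codingMap_mem ω 0
  ext ω
  refine ⟨fun h => ?_, fun h => ?_⟩
  · by_contra hne
    have := hsep [] (ω.1 0) i hne (by simp [IsWord]) (by simp [IsWord]) _ (h0 ω) _ h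
    rw [dist_self] at this
    have h1 := lt_max_of_lt_left (c := Metric.diam (J [i])) (hJ.diam_pos (ω.1 0))
    exact absurd this (not_le.2 (mul_pos ht0 h1))
  · have := h0 ω
    rwa [show ω.1 0 = i from h] at this

/-- The conditional measure `μ(· | J_i)` is the image of the Markov chain started in `i`. -/
lemma cond_map_codingMap [NormedSpace ℝ V] [Nontrivial V] [MeasurableSpace V] [BorelSpace V]
    (hJ : IsCylinderSystem P c J) (hsep : IsSeparated P J) (m : Measure (InfWord P)) (i : Fin N) :
    ProbabilityTheory.cond (m.map (codingMap P J)) (J [i]) =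
      (ProbabilityTheory.cond m {ω | ω.1 0 = i}).map (codingMap P J) := by
  have hm := hJ.measurable_codingMap
  have hi : MeasurableSet (J [i]) := (hJ.isCompact i).measurableSet
  rw [ProbabilityTheory.cond, ProbabilityTheory.cond, Measure.map_apply hm hi,
    hJ.codingMap_preimage hsep, Measure.map_smul, Measure.restrict_map hm hi,
    hJ.codingMap_preimage hsep]

end Geometry

/-! ### The exponent and the Poisson equation -/

section Poisson

variable {N : ℕ} {P : Matrix (Fin N) (Fin N) ℝ}

lemma lt_one_of_two_le_card (hP : P ∈ Matrix.rowStochastic ℝ (Fin N))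
    (hcard : ∀ i, 2 ≤ (Finset.univ.filter fun j => 0 < P i j).card) (i j : Fin N) :
    P i j < 1 := by
  obtain ⟨k, hk, hkj⟩ := Finset.exists_mem_ne (hcard i) j
  rw [← Matrix.sum_row_of_mem_rowStochastic hP i]
  exact Finset.single_lt_sum hkj (Finset.mem_univ j) (Finset.mem_univ k)
    (Finset.mem_filter.1 hk).2 fun _ _ _ => Matrix.nonneg_of_mem_rowStochastic hP

/-- A weighted mean of logarithms of numbers in `(0, 1)` is negative. -/
lemma sum_mul_log_neg (hcard : ∀ i, 2 ≤ (Finset.univ.filter fun j => 0 < P i j).card)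
    {v : Fin N → ℝ} (hv : IsPerronVector P v) {a : Matrix (Fin N) (Fin N) ℝ}
    (ha : ∀ i j, 0 < P i j → 0 < a i j ∧ a i j < 1) :
    ∑ i, v i * ∑ j with 0 < P i j, P i j * Real.log (a i j) < 0 := by
  have hne : (Finset.univ : Finset (Fin N)).Nonempty := by
    rw [Finset.univ_nonempty_iff]
    by_contra h
    rw [not_nonempty_iff] at h
    simpa using hv.sum_eq_one
  refine Finset.sum_neg (fun i _ => mul_neg_of_pos_of_neg (hv.pos i) ?_) hne
  refine Finset.sum_neg (fun j hj => ?_) (Finset.card_pos.1 (zero_lt_two.trans_le (hcard i)))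
  have hj := (Finset.mem_filter.1 hj).2
  exact mul_neg_of_pos_of_neg hj (Real.log_neg (ha i j hj).1 (ha i j hj).2)

/-- The maximum principle: harmonic functions of an irreducible stochastic matrix are constant. -/
lemma eq_of_mulVec_eq_self (hP : P ∈ Matrix.rowStochastic ℝ (Fin N)) (hirr : P.IsIrreducible)
    {h : Fin N → ℝ} (hh : P.mulVec h = h) (i j : Fin N) : h i = h j := by
  have hne : Nonempty (Fin N) := ⟨i⟩
  obtain ⟨l, hl⟩ := Finite.exists_max h
  have key : ∀ j, h l = h j := fun j => by
    obtain ⟨k, -, hk⟩ := (Matrix.isIrreducible_iff_exists_pow_pos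
      fun _ _ => Matrix.nonneg_of_mem_rowStochastic hP).1 hirr l j
    have hPk : P ^ k ∈ Matrix.rowStochastic ℝ (Fin N) := pow_mem hP k
    have hkh : (P ^ k).mulVec h = h := by
      clear hk hPk
      induction k with
      | zero => simp
      | succ k ih => rw [pow_succ, ← Matrix.mulVec_mulVec, hh, ih]
    have hsum : ∑ b, (P ^ k) l b * (h l - h b) = 0 := by
      have h1 : ∑ b, (P ^ k) l b * h b = h l := congrFun hkh l
      simp only [mul_sub, Finset.sum_sub_distrib]
      rw [← Finset.sum_mul, Matrix.sum_row_of_mem_rowStochastic hPk, h1, one_mul, sub_self]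
    have h0 := (Finset.sum_eq_zero_iff_of_nonneg fun b _ =>
      mul_nonneg (Matrix.nonneg_of_mem_rowStochastic hPk) (sub_nonneg.2 (hl b))).1 hsum j
        (Finset.mem_univ j)
    rcases mul_eq_zero.1 h0 with h0 | h0
    · exact absurd h0 hk.ne'
    · exact sub_eq_zero.1 h0
  rw [← key i, key j]

/-- The Poisson equation `(1 - P) h = u` is solvable as soon as `u` is orthogonal to the left
eigenvector: the range of `1 - P` lies in this orthogonal complement, and has the same dimension
because the kernel consists of the constants. -/
lemma exists_poisson (hP : P ∈ Matrix.rowStochastic ℝ (Fin N)) (hirr : P.IsIrreducible)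
    {v : Fin N → ℝ} (hv : IsPerronVector P v) {u : Fin N → ℝ} (hu : ∑ i, v i * u i = 0) :
    ∃ h : Fin N → ℝ, ∀ i, h i - ∑ j, P i j * h j = u i := by
  let L : (Fin N → ℝ) →ₗ[ℝ] (Fin N → ℝ) := LinearMap.id - P.mulVecLin
  have hL : ∀ h, L h = h - P.mulVec h := fun h => rfl
  let φ : Module.Dual ℝ (Fin N → ℝ) := dotProductBilin ℝ ℝ v
  have hφ : ∀ h, φ h = ∑ i, v i * h i := fun h => rfl
  have hφ0 : φ ≠ 0 := fun h0 => by
    have := hφ 1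
    rw [h0] at this
    simp [hv.sum_eq_one] at this
  have hker : LinearMap.ker L ≤ Submodule.span ℝ {1} := fun h hh => by
    rw [LinearMap.mem_ker, hL, sub_eq_zero] at hh
    rw [Submodule.mem_span_singleton]
    rcases isEmpty_or_nonempty (Fin N) with he | ⟨⟨i⟩⟩
    · exact ⟨0, Subsingleton.elim _ _⟩
    · exact ⟨h i, funext fun j => by
        simpa using eq_of_mulVec_eq_self hP hirr hh.symm i j⟩
  have hle : LinearMap.range L ≤ LinearMap.ker φ := by
    rintro _ ⟨h, rfl⟩
    rw [LinearMap.mem_ker, hL, map_sub, sub_eq_zero]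
    change v ⬝ᵥ h = v ⬝ᵥ P.mulVec h
    rw [Matrix.dotProduct_mulVec, hv.left_eigen]
  have h1 : Module.finrank ℝ (LinearMap.ker L) ≤ 1 :=
    (Submodule.finrank_mono hker).trans ((finrank_span_le_card _).trans (by simp))
  have h2 := LinearMap.finrank_range_add_finrank_ker L
  have h3 := Module.Dual.finrank_ker_add_one_of_ne_zero hφ0
  have heq := Submodule.eq_of_le_of_finrank_le hle (by omega)
  have hmem : u ∈ LinearMap.range L := by rw [heq, LinearMap.mem_ker, hφ, hu]
  obtain ⟨h, hh⟩ := hmem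
  exact ⟨h, fun i => congrFun hh i⟩

variable {c : Matrix (Fin N) (Fin N) ℝ} {v : Fin N → ℝ}

lemma exponent_pos (hP : P ∈ Matrix.rowStochastic ℝ (Fin N))
    (hcard : ∀ i, 2 ≤ (Finset.univ.filter fun j => 0 < P i j).card)
    (hc : ∀ i j, 0 < P i j → 0 < c i j ∧ c i j < 1) (hv : IsPerronVector P v) :
    0 < exponent P c v :=
  div_pos_of_neg_of_neg
    (sum_mul_log_neg hcard hv fun i j h => ⟨h, lt_one_of_two_le_card hP hcard i j⟩)
    (sum_mul_log_neg hcard hv hc)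

/-- At the exponent `s₀` the function `log p_{ij} - s₀ log c_{ij}` is, up to a coboundary, a
martingale increment. -/
lemma exists_martingale_corrector (hP : P ∈ Matrix.rowStochastic ℝ (Fin N))
    (hirr : P.IsIrreducible) (hcard : ∀ i, 2 ≤ (Finset.univ.filter fun j => 0 < P i j).card)
    (hc : ∀ i j, 0 < P i j → 0 < c i j ∧ c i j < 1) (hv : IsPerronVector P v) :
    ∃ h : Fin N → ℝ, ∀ i, ∑ j, P i j *
      (Real.log (P i j) - exponent P c v * Real.log (c i j) + h j - h i) = 0 := by
  have hfilter : ∀ (f : Fin N → Fin N → ℝ) i,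
      ∑ j with 0 < P i j, P i j * f i j = ∑ j, P i j * f i j := fun f i => by
    refine Finset.sum_subset (Finset.filter_subset _ _) fun j _ hj => ?_
    have h0 : P i j = 0 := le_antisymm (by simpa using hj) (Matrix.nonneg_of_mem_rowStochastic hP)
    rw [h0, zero_mul]
  have hden := (sum_mul_log_neg hcard hv hc).ne
  have hs : (∑ i, v i * ∑ j, P i j * Real.log (P i j)) =
      exponent P c v * ∑ i, v i * ∑ j, P i j * Real.log (c i j) := by
    have : exponent P c v * _ = _ := div_mul_cancel₀ _ hden
    simpa only [hfilter fun i j => Real.log (P i j), hfilter fun i j => Real.log (c i j)]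
      using this.symm
  obtain ⟨h, hh⟩ := exists_poisson hP hirr hv
    (u := fun i => ∑ j, P i j * Real.log (P i j) -
      exponent P c v * ∑ j, P i j * Real.log (c i j)) (by
    simp only [mul_sub, Finset.sum_sub_distrib]
    rw [hs, Finset.mul_sum, sub_eq_zero]
    exact Finset.sum_congr rfl fun i _ => by ring)
  refine ⟨h, fun i => ?_⟩
  have h1 : ∑ j, P i j * (Real.log (P i j) - exponent P c v * Real.log (c i j) + h j - h i) =
      (∑ j, P i j * Real.log (P i j) - exponent P c v * ∑ j, P i j * Real.log (c i j)) +
        ∑ j, P i j * h j - (∑ j, P i j) * h i := by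
    rw [Finset.mul_sum, Finset.sum_mul, ← Finset.sum_sub_distrib, ← Finset.sum_add_distrib,
      ← Finset.sum_sub_distrib]
    exact Finset.sum_congr rfl fun j _ => by ring
  rw [h1, Matrix.sum_row_of_mem_rowStochastic hP, ← hh i]
  ring

/-- Optional stopping for the corrected martingale: the mean logarithm of the contraction ratio of
the stopped cylinder is `s⁻¹ log ε`, up to a bounded error. -/
lemma IsChainLaw.integral_log_pathProd_bounds {s ρ ε δ H : ℝ}
    (hP : ∀ i j, 0 ≤ P i j) (hρ : ∀ i j, P i j ≤ ρ) (hρ1 : ρ < 1) (hε : 0 < ε) (hε1 : ε ≤ 1)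
    (hδ0 : 0 < δ) (hδ : ∀ i j, 0 < P i j → δ ≤ P i j) (hc : ∀ i j, 0 < P i j → 0 < c i j)
    {i : Fin N} {ν : Measure (InfWord P)} (hν : IsChainLaw P i ν) {h : Fin N → ℝ}
    (hh : ∀ i, ∑ j, P i j * (Real.log (P i j) - s * Real.log (c i j) + h j - h i) = 0)
    (hH : ∀ j, |h j| ≤ H) :
    Real.log (ε * δ) - 2 * H ≤
        s * ∫ ω : InfWord P, Real.log (pathProd c ω.1 (stopLevel P ε ω.1)) ∂ν ∧
      s * ∫ ω : InfWord P, Real.log (pathProd c ω.1 (stopLevel P ε ω.1)) ∂ν ≤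
        Real.log ε + 2 * H := by
  have := hν.isProb
  set u : Fin N → Fin N → ℝ := fun i j =>
    Real.log (P i j) - s * Real.log (c i j) + h j - h i with hu
  let T : InfWord P → ℕ := fun ω => stopLevel P ε ω.1
  have hM := hν.integral_sum_stopLevel hP hρ hρ1 hε (u := u) hh
  have hintc : Integrable (fun ω : InfWord P => Real.log (pathProd c ω.1 (T ω))) ν :=
    (measurable_integrable_stopped hP hρ hρ1 hε ν (f := fun k x => Real.log (pathProd c x k))
      fun k x y hxy => by rw [pathProd_congr hxy]).2
  have hintM : Integrable
      (fun ω : InfWord P => ∑ k ∈ Finset.range (T ω), u (ω.1 k) (ω.1 (k + 1))) ν :=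
    (measurable_integrable_stopped hP hρ hρ1 hε ν
      (f := fun k x => ∑ l ∈ Finset.range k, u (x l) (x (l + 1))) fun k x y hxy =>
        Finset.sum_congr rfl fun l hl => by
          have hl := Finset.mem_range.1 hl
          rw [hxy l hl.le, hxy (l + 1) hl]).2
  have hsum : ∀ ω : InfWord P, s * Real.log (pathProd c ω.1 (T ω)) +
      ∑ k ∈ Finset.range (T ω), u (ω.1 k) (ω.1 (k + 1)) =
        Real.log (pathProd P ω.1 (T ω)) + (h (ω.1 (T ω)) - h (ω.1 0)) := fun ω => by
    rw [log_pathProd hc, log_pathProd (fun _ _ hp => hp),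
      ← Finset.sum_range_sub (fun k => h (ω.1 k)), Finset.mul_sum, ← Finset.sum_add_distrib,
      ← Finset.sum_add_distrib]
    exact Finset.sum_congr rfl fun k _ => by simp only [hu]; ring
  have heq : s * ∫ ω : InfWord P, Real.log (pathProd c ω.1 (T ω)) ∂ν =
      ∫ ω : InfWord P, (s * Real.log (pathProd c ω.1 (T ω)) +
        ∑ k ∈ Finset.range (T ω), u (ω.1 k) (ω.1 (k + 1))) ∂ν := by
    rw [integral_add (hintc.const_mul s) hintM, hM, integral_const_mul, add_zero]
  have hint := (hintc.const_mul s).add hintM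
  obtain ⟨K, hK⟩ := exists_stopLevel_le hP hρ hρ1 hε
  have hosc : ∀ ω : InfWord P, |h (ω.1 (T ω)) - h (ω.1 0)| ≤ 2 * H := fun ω => by
    have := abs_sub (h (ω.1 (T ω))) (h (ω.1 0))
    linarith [hH (ω.1 (T ω)), hH (ω.1 0)]
  change _ ≤ s * ∫ ω : InfWord P, Real.log (pathProd c ω.1 (T ω)) ∂ν ∧
    s * ∫ ω : InfWord P, Real.log (pathProd c ω.1 (T ω)) ∂ν ≤ _
  rw [heq]
  constructor
  · have h1 : ∀ ω : InfWord P, Real.log (ε * δ) - 2 * H ≤ s * Real.log (pathProd c ω.1 (T ω)) +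
        ∑ k ∈ Finset.range (T ω), u (ω.1 k) (ω.1 (k + 1)) := fun ω => by
      rw [hsum]
      have h2 := Real.log_le_log (mul_pos hε hδ0)
        (mul_le_pathProd_stopLevel hP hρ hρ1 hε hε1 hδ0.le hδ ω)
      linarith [(abs_le.1 (hosc ω)).1]
    simpa using integral_mono (μ := ν) (integrable_const _) hint h1
  · have h1 : ∀ ω : InfWord P, s * Real.log (pathProd c ω.1 (T ω)) +
        ∑ k ∈ Finset.range (T ω), u (ω.1 k) (ω.1 (k + 1)) ≤ Real.log ε + 2 * H := fun ω => by
      rw [hsum]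
      have h2 := Real.log_le_log (pathProd_pos (fun _ _ hp => hp) ω (T ω)) (hK ω.1).1.le
      linarith [(abs_le.1 (hosc ω)).2]
    simpa using integral_mono (μ := ν) hint (integrable_const _) h1

end Poisson

/-! ### Estimates for the logarithmic integral -/

section LogIntegral

variable {V : Type*} [NormedAddCommGroup V] [NormedSpace ℝ V]

lemma toENNReal_neg_log_le {x : ℝ≥0∞} {r : ℝ} (hr : 0 < r) (hx : ENNReal.ofReal r ≤ x) :
    (-ENNReal.log x).toENNReal ≤ ENNReal.ofReal (-Real.log r) := by
  have h1 := ENNReal.log_monotone hx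
  rw [ENNReal.log_ofReal_of_pos hr] at h1
  have h2 := EReal.toENNReal_le_toENNReal (EReal.neg_le_neg_iff.2 h1)
  rwa [← EReal.coe_neg, EReal.real_coe_toENNReal] at h2

/-- Layered bound for the negative part of the logarithm: descending along a sequence of radii that
decreases at most geometrically, each radius undershot costs at most `L`. The value `x = 0` is
allowed, for which both sides are infinite. -/
lemma toENNReal_neg_log_le_tsum {x : ℝ≥0∞} {r : ℕ → ℝ} {L : ℝ} (hL : 0 < L) (hr : ∀ j, 0 < r j)
    (hstep : ∀ j, Real.log (r j) - L ≤ Real.log (r (j + 1))) :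
    (-ENNReal.log x).toENNReal ≤ ENNReal.ofReal (-Real.log (r 0)) +
      ∑' j, {j | x < ENNReal.ofReal (r j)}.indicator (fun _ => ENNReal.ofReal L) j := by
  classical
  by_cases hall : ∀ j, x < ENNReal.ofReal (r j)
  · have : {j | x < ENNReal.ofReal (r j)} = Set.univ := Set.eq_univ_of_forall hall
    simp only [this, Set.indicator_univ]
    rw [ENNReal.tsum_const_eq_top_of_ne_zero (by simpa using hL)]
    simp
  · push Not at hall
    have hmin := fun k (hk : k < Nat.find hall) => not_le.1 (Nat.find_min hall hk)
    have hspec := Nat.find_spec hall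
    set j := Nat.find hall
    have hsum : ENNReal.ofReal (j * L) ≤
        ∑' k, {k | x < ENNReal.ofReal (r k)}.indicator (fun _ => ENNReal.ofReal L) k := by
      refine le_trans (le_of_eq ?_) (ENNReal.sum_le_tsum (Finset.range j))
      rw [Finset.sum_congr rfl fun k hk => Set.indicator_of_mem
        (s := {k | x < ENNReal.ofReal (r k)}) (hmin k (Finset.mem_range.1 hk)) _]
      rw [Finset.sum_const, Finset.card_range, nsmul_eq_mul, ENNReal.ofReal_mul (by positivity),
        ENNReal.ofReal_natCast]
    have hlog : ∀ k : ℕ, Real.log (r 0) - k * L ≤ Real.log (r k) := fun k => by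
      induction k with
      | zero => simp
      | succ k ih =>
        push_cast
        linarith [hstep k]
    calc (-ENNReal.log x).toENNReal ≤ ENNReal.ofReal (-Real.log (r j)) :=
          toENNReal_neg_log_le (hr j) hspec
      _ ≤ ENNReal.ofReal (-Real.log (r 0) + j * L) :=
          ENNReal.ofReal_le_ofReal (by linarith [hlog j])
      _ ≤ _ := ENNReal.ofReal_add_le.trans (by gcongr)

lemma neg_le_logIntegral [MeasurableSpace V] (d : Seminorm ℝ V) (ν : Measure V) (α : Finset V)
    {E : ℝ} (hE : 0 ≤ E)
    (h : ∫⁻ x, (-ENNReal.log (distToSet d x α)).toENNReal ∂ν ≤ ENNReal.ofReal E) :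
    ((-E : ℝ) : EReal) ≤ logIntegral d ν α := by
  have h1 : ((∫⁻ x, (-ENNReal.log (distToSet d x α)).toENNReal ∂ν : ℝ≥0∞) : EReal) ≤
      (E : EReal) := by
    have := EReal.coe_ennreal_le_coe_ennreal_iff.2 h
    rwa [EReal.coe_ennreal_ofReal, max_eq_left hE] at this
  have h2 := EReal.sub_le_sub (EReal.coe_ennreal_nonneg
    (∫⁻ x, (ENNReal.log (distToSet d x α)).toENNReal ∂ν)) h1
  rw [zero_sub, ← EReal.coe_neg] at h2
  exact h2

lemma natCast_rpow_eq_ofReal_exp {n : ℕ} (hn : 1 ≤ n) (z : ℝ) :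
    (n : ℝ≥0∞) ^ z = ENNReal.ofReal (Real.exp (z * Real.log n)) := by
  have hn' : (0 : ℝ) < n := by exact_mod_cast hn
  rw [← ENNReal.ofReal_natCast, ENNReal.ofReal_rpow_of_pos hn', Real.rpow_def_of_pos hn', mul_comm]

/-- Bounds `|log e_n + s⁻¹ log n| = O(1)` give positive and finite quantization coefficients. -/
lemma quantCoeff_bounds [MeasurableSpace V] (d : Seminorm ℝ V) (ν : Measure V) {s B C : ℝ}
    (hlow : ∀ n : ℕ, 1 ≤ n → ∀ α : Finset V, 1 ≤ α.card → α.card ≤ n →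
      ((-(1 / s * Real.log n) - B : ℝ) : EReal) ≤ logIntegral d ν α)
    (hup : ∀ᶠ n : ℕ in atTop, ∃ α : Finset V, 1 ≤ α.card ∧ α.card ≤ n ∧
      logIntegral d ν α ≤ ((-(1 / s * Real.log n) + C : ℝ) : EReal)) :
    0 < lowerQuantCoeff d s ν ∧ lowerQuantCoeff d s ν ≤ upperQuantCoeff d s ν ∧
      upperQuantCoeff d s ν < ∞ := by
  refine ⟨?_, liminf_le_limsup, ?_⟩
  · have hpos : 0 < ENNReal.ofReal (Real.exp (-B)) := by simp [Real.exp_pos]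
    refine hpos.trans_le (le_liminf_of_le (by isBoundedDefault) ?_)
    filter_upwards [eventually_ge_atTop 1] with n hn
    have h1 : ENNReal.ofReal (Real.exp (-(1 / s * Real.log n) - B)) ≤ geomMeanError d ν n :=
      le_iInf₂ fun α hα => EReal.exp_monotone (hlow n hn α hα.1 hα.2)
    refine le_trans (le_of_eq ?_) (mul_le_mul_right h1 _)
    rw [natCast_rpow_eq_ofReal_exp hn, ← ENNReal.ofReal_mul (Real.exp_pos _).le, ← Real.exp_add]
    congr 2
    ring
  · refine lt_of_le_of_lt (limsup_le_of_le (by isBoundedDefault) ?_)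
      (ENNReal.ofReal_lt_top (r := Real.exp C))
    filter_upwards [eventually_ge_atTop 1, hup] with n hn ⟨α, hα1, hαn, hα⟩
    have h1 : geomMeanError d ν n ≤ ENNReal.ofReal (Real.exp (-(1 / s * Real.log n) + C)) :=
      (iInf₂_le α ⟨hα1, hαn⟩).trans (EReal.exp_monotone hα)
    refine (mul_le_mul_right h1 _).trans (le_of_eq ?_)
    rw [natCast_rpow_eq_ofReal_exp hn, ← ENNReal.ofReal_mul (Real.exp_pos _).le, ← Real.exp_add]
    congr 2
    ring

variable [FiniteDimensional ℝ V]

lemma continuous_seminorm (d : Seminorm ℝ V) : Continuous d := by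
  have := (d.convexOn).continuousOn isOpen_univ
  exact continuousOn_univ.1 this

/-- All norms on a finite-dimensional space are equivalent. -/
lemma exists_seminorm_bounds [Nontrivial V] (d : Seminorm ℝ V) (hd : ∀ x, d x = 0 → x = 0) :
    ∃ A B : ℝ, 0 < A ∧ 0 < B ∧ ∀ x, A * ‖x‖ ≤ d x ∧ d x ≤ B * ‖x‖ := by
  have hcont := continuous_seminorm d
  obtain ⟨B, hB0, hB⟩ := d.bound_of_continuous_normedSpace hcont
  obtain ⟨z, hz, hmin⟩ := (isCompact_sphere (0 : V) 1).exists_isMinOn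
    (NormedSpace.sphere_nonempty.2 zero_le_one) hcont.continuousOn
  have hz1 : ‖z‖ = 1 := by simpa using hz
  have hz0 : z ≠ 0 := fun h => by simp [h] at hz1
  have hdz : 0 < d z := lt_of_le_of_ne (apply_nonneg d z) fun h => hz0 (hd z h.symm)
  refine ⟨d z, B, hdz, hB0, fun x => ⟨?_, hB x⟩⟩
  rcases eq_or_ne x 0 with rfl | hx
  · simp
  · have hx' : 0 < ‖x‖ := norm_pos_iff.2 hx
    have h1 : d z ≤ d (‖x‖⁻¹ • x) := hmin (by simp [norm_smul, hx'.ne'])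
    rw [map_smul_eq_mul, norm_inv, norm_norm] at h1
    rwa [← le_inv_mul_iff₀' hx']

lemma measurable_distToSet [MeasurableSpace V] [BorelSpace V] (d : Seminorm ℝ V) (α : Finset V) :
    Measurable fun x => distToSet d x α := by
  refine Measurable.biInf _ α.countable_toSet fun a _ => ?_
  exact ((continuous_seminorm d).comp
    (continuous_id.sub continuous_const)).measurable.ennreal_ofReal

lemma logIntegral_map [MeasurableSpace V] [BorelSpace V] {Ω : Type*} [MeasurableSpace Ω]
    (d : Seminorm ℝ V) (ν : Measure Ω) {g : Ω → V} (hg : Measurable g) (α : Finset V) :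
    logIntegral d (ν.map g) α =
      ((∫⁻ ω, (ENNReal.log (distToSet d (g ω) α)).toENNReal ∂ν : ℝ≥0∞) : EReal) -
        ((∫⁻ ω, (-ENNReal.log (distToSet d (g ω) α)).toENNReal ∂ν : ℝ≥0∞) : EReal) := by
  have h1 := (measurable_distToSet d α).ennreal_log
  have h2 : Measurable fun x => -ENNReal.log (distToSet d x α) := h1.neg
  rw [logIntegral, lintegral_map h1.ereal_toENNReal hg, lintegral_map h2.ereal_toENNReal hg]

/-- If almost every `g ω` is within `exp (K + f ω)` of `α`, where `f ≤ 0`, then the logarithmic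
integral is at most the mean of `f`, up to a multiple of `K`. -/
lemma logIntegral_map_le [MeasurableSpace V] [BorelSpace V] {Ω : Type*} [MeasurableSpace Ω]
    (d : Seminorm ℝ V) (ν : Measure Ω) [IsProbabilityMeasure ν] {g : Ω → V} (hg : Measurable g)
    (α : Finset V) {f : Ω → ℝ} (hf : Integrable f ν) (hf0 : ∀ ω, f ω ≤ 0)
    {K : ℝ} (hK : 0 ≤ K)
    (h : ∀ᵐ ω ∂ν, distToSet d (g ω) α ≤ ENNReal.ofReal (Real.exp (K + f ω))) :
    logIntegral d (ν.map g) α ≤ ((2 * K + ∫ ω, f ω ∂ν : ℝ) : EReal) := by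
  rw [logIntegral_map d ν hg]
  have hlog : ∀ᵐ ω ∂ν, ENNReal.log (distToSet d (g ω) α) ≤ ((K + f ω : ℝ) : EReal) := by
    filter_upwards [h] with ω hω
    have := ENNReal.log_monotone hω
    rwa [ENNReal.log_ofReal_of_pos (Real.exp_pos _), Real.log_exp] at this
  have hpos : ∫⁻ ω, (ENNReal.log (distToSet d (g ω) α)).toENNReal ∂ν ≤ ENNReal.ofReal K := by
    calc _ ≤ ∫⁻ _, ENNReal.ofReal K ∂ν := by
          refine lintegral_mono_ae ?_
          filter_upwards [hlog] with ω hω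
          have := EReal.toENNReal_le_toENNReal hω
          rw [EReal.real_coe_toENNReal] at this
          exact this.trans (ENNReal.ofReal_le_ofReal (by linarith [hf0 ω]))
      _ = _ := by simp
  have hneg : ENNReal.ofReal (-∫ ω, f ω ∂ν) ≤
      (∫⁻ ω, (-ENNReal.log (distToSet d (g ω) α)).toENNReal ∂ν) + ENNReal.ofReal K := by
    rw [← integral_neg, ofReal_integral_eq_lintegral_ofReal (f := fun ω => -f ω) hf.neg
      (Eventually.of_forall fun ω => by simpa using hf0 ω)]
    calc ∫⁻ ω, ENNReal.ofReal (-f ω) ∂ν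
        ≤ ∫⁻ ω, ((-ENNReal.log (distToSet d (g ω) α)).toENNReal + ENNReal.ofReal K) ∂ν := by
          refine lintegral_mono_ae ?_
          filter_upwards [hlog] with ω hω
          have := EReal.toENNReal_le_toENNReal (EReal.neg_le_neg_iff.2 hω)
          rw [← EReal.coe_neg, EReal.real_coe_toENNReal] at this
          calc ENNReal.ofReal (-f ω) = ENNReal.ofReal (-(K + f ω) + K) := by congr 1; ring
            _ ≤ ENNReal.ofReal (-(K + f ω)) + ENNReal.ofReal K := ENNReal.ofReal_add_le
            _ ≤ _ := by gcongr
      _ = _ := by rw [lintegral_add_right _ measurable_const]; simp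
  have hneg' : ENNReal.ofReal (-(∫ ω, f ω ∂ν) - K) ≤
      ∫⁻ ω, (-ENNReal.log (distToSet d (g ω) α)).toENNReal ∂ν := by
    rw [ENNReal.ofReal_sub _ hK]
    exact tsub_le_iff_right.2 hneg
  have h1 : ((∫⁻ ω, (ENNReal.log (distToSet d (g ω) α)).toENNReal ∂ν : ℝ≥0∞) : EReal) ≤
      (K : EReal) := by
    have := EReal.coe_ennreal_le_coe_ennreal_iff.2 hpos
    rwa [EReal.coe_ennreal_ofReal, max_eq_left hK] at this
  have h2 : ((-(∫ ω, f ω ∂ν) - K : ℝ) : EReal) ≤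
      ((∫⁻ ω, (-ENNReal.log (distToSet d (g ω) α)).toENNReal ∂ν : ℝ≥0∞) : EReal) := by
    refine le_trans ?_ (EReal.coe_ennreal_le_coe_ennreal_iff.2 hneg')
    rw [EReal.coe_ennreal_ofReal]
    exact EReal.coe_le_coe_iff.2 (le_max_left _ _)
  refine (EReal.sub_le_sub h1 h2).trans (le_of_eq ?_)
  rw [← EReal.coe_sub]
  congr 1
  ring

end LogIntegral

/-! ### Upper and lower estimates for the quantization error -/

section Estimates

variable {N : ℕ} {V : Type*} [NormedAddCommGroup V] {P c : Matrix (Fin N) (Fin N) ℝ}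
  {J : List (Fin N) → Set V} {i : Fin N} {ν : Measure (InfWord P)} {ρ ε δ : ℝ}

/-- One point from each stopped cylinder: since the stopped cylinders are disjoint of probability
at least `ε δ`, there are at most `(ε δ)⁻¹` of them. -/
lemma IsChainLaw.exists_stopped_net (hν : IsChainLaw P i ν) (hJ : IsCylinderSystem P c J)
    (hP : ∀ i j, 0 ≤ P i j) (hρ : ∀ i j, P i j ≤ ρ) (hρ1 : ρ < 1) (hε : 0 < ε) (hε1 : ε ≤ 1)
    (hδ0 : 0 < δ) (hδ : ∀ i j, 0 < P i j → δ ≤ P i j) :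
    ∃ α : Finset V, 1 ≤ α.card ∧ α.card * (ε * δ) ≤ 1 ∧ ∀ᵐ ω ∂ν, ∃ a ∈ α,
      dist (codingMap P J ω) a ≤ Metric.diam (levelSet J ω (stopLevel P ε ω.1)) := by
  classical
  have := hν.isProb
  obtain ⟨K, hK⟩ := exists_stopLevel_le hP hρ hρ1 hε
  let T : InfWord P → ℕ := fun ω => stopLevel P ε ω.1
  let cell : InfWord P → List (Fin N) := fun ω => initialWord ω.1 (T ω + 1)
  let S : Set (InfWord P) := {ω | ω.1 0 = i}
  have hcell : ∀ ω ω' : InfWord P, ω' ∈ pathCylinder P ω.1 (T ω) ↔ cell ω' = cell ω := by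
    intro ω ω'
    constructor
    · intro h
      have hT : T ω' = T ω := stopLevel_eq hP hρ hρ1 hε h
      simp only [cell, hT]
      exact initialWord_eq_iff.2 fun l hl => h l (Nat.le_of_lt_succ hl)
    · intro h l hl
      have hlen := congrArg List.length h
      simp only [cell, length_initialWord] at hlen
      simp only [cell, hlen] at h
      exact initialWord_eq_iff.1 h l (Nat.lt_succ_of_le hl)
  have hfin : (cell '' S).Finite := by
    refine (List.finite_length_le (Fin N) (K + 1)).subset ?_
    rintro _ ⟨ω, -, rfl⟩
    simpa [cell] using (hK ω.1).2
  have hrep : ∀ w ∈ hfin.toFinset, ∃ ω ∈ S, cell ω = w := fun w hw => hfin.mem_toFinset.1 hw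
  obtain ⟨ω₀, hω₀⟩ := hν.ae_first.exists
  have hne : Nonempty (InfWord P) := ⟨ω₀⟩
  choose! rep hrepS hrep using hrep
  have hcard : (hfin.toFinset.card : ℝ) * (ε * δ) ≤ 1 := by
    have hdisj : (hfin.toFinset : Set (List (Fin N))).PairwiseDisjoint
        fun w => pathCylinder P (rep w).1 (T (rep w)) := by
      intro w hw w' hw' hne
      refine Set.disjoint_left.2 fun ω h1 h2 => hne ?_
      rw [← hrep w hw, ← hrep w' hw', ← (hcell _ _).1 h1, ← (hcell _ _).1 h2]
    have h1 : ∑ w ∈ hfin.toFinset, ν.real (pathCylinder P (rep w).1 (T (rep w))) ≤ 1 := by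
      rw [← measureReal_biUnion_finset hdisj fun w _ => measurableSet_pathCylinder _ _]
      exact measureReal_le_one
    refine le_trans ?_ h1
    rw [← nsmul_eq_mul]
    refine Finset.card_nsmul_le_sum _ _ _ fun w hw => ?_
    rw [Measure.real, hν.cylinder _ _ (hrepS w hw), ENNReal.toReal_ofReal (pathProd_nonneg hP _ _)]
    exact mul_le_pathProd_stopLevel hP hρ hρ1 hε hε1 hδ0.le hδ (rep w)
  have hcover : ∀ ω ∈ S, cell ω ∈ hfin.toFinset := fun ω hω =>
    hfin.mem_toFinset.2 (Set.mem_image_of_mem _ hω)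
  refine ⟨hfin.toFinset.image fun w => codingMap P J (rep w), ?_, ?_, ?_⟩
  · exact Finset.card_pos.2 ⟨_, Finset.mem_image_of_mem _ (hcover ω₀ hω₀)⟩
  · refine le_trans (mul_le_mul_of_nonneg_right ?_ (mul_pos hε hδ0).le) hcard
    exact_mod_cast Finset.card_image_le
  · filter_upwards [hν.ae_first] with ω hω
    have hw := hcover ω hω
    refine ⟨_, Finset.mem_image_of_mem _ hw, ?_⟩
    have hmem : rep (cell ω) ∈ pathCylinder P ω.1 (T ω) := (hcell _ _).2 (hrep _ hw)
    refine Metric.dist_le_diam_of_mem (hJ.isCompact_levelSet ω (T ω)).isBounded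
      (hJ.codingMap_mem ω _) ?_
    rw [← levelSet_congr fun l hl => hmem l hl]
    exact hJ.codingMap_mem _ _

/-- For a single point, the words whose image is closer to it than half the separation distance at
level `T + j` have probability at most `ε ρ ^ j`, because they lie in one cylinder. -/
lemma IsChainLaw.exists_small_cylinder (hν : IsChainLaw P i ν) (hJ : IsCylinderSystem P c J)
    (hP : ∀ i j, 0 ≤ P i j) (hρ : ∀ i j, P i j ≤ ρ) (hρ0 : 0 ≤ ρ) (hρ1 : ρ < 1) (hε : 0 < ε)
    {t : ℝ} (ht : 0 ≤ t)
    (hsep : ∀ σ j₁ j₂, j₁ ≠ j₂ → IsWord P (σ ++ [j₁]) → IsWord P (σ ++ [j₂]) →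
      ∀ x ∈ J (σ ++ [j₁]), ∀ y ∈ J (σ ++ [j₂]),
        t * max (Metric.diam (J (σ ++ [j₁]))) (Metric.diam (J (σ ++ [j₂]))) ≤ dist x y)
    (a : V) (j : ℕ) :
    ∃ C : Set (InfWord P), MeasurableSet C ∧ ν C ≤ ENNReal.ofReal (ε * ρ ^ j) ∧
      ∀ ω : InfWord P, ω.1 0 = i → dist (codingMap P J ω) a <
        t / 2 * Metric.diam (levelSet J ω (stopLevel P ε ω.1 + j)) → ω ∈ C := by
  obtain ⟨K, hK⟩ := exists_stopLevel_le hP hρ hρ1 hε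
  let S : Set (InfWord P) := {ω | ω.1 0 = i ∧ dist (codingMap P J ω) a <
    t / 2 * Metric.diam (levelSet J ω (stopLevel P ε ω.1 + j))}
  rcases S.eq_empty_or_nonempty with hS | hS
  · refine ⟨∅, MeasurableSet.empty, by simp, fun ω h1 h2 => ?_⟩
    rw [← hS]
    exact ⟨h1, h2⟩
  · obtain ⟨ω, hω, hsub⟩ := hJ.exists_cylinder_of_close ht hsep
      (fun ω => stopLevel P ε ω.1 + j) a (fun ω (hω : ω ∈ S) => hω.2) hS
    refine ⟨_, measurableSet_pathCylinder _ _, ?_, fun ω' h1 h2 => hsub ⟨h1, h2⟩⟩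
    rw [hν.cylinder _ _ hω.1]
    refine ENNReal.ofReal_le_ofReal ((pathProd_add_le hP hρ _ _ _).trans ?_)
    exact mul_le_mul_of_nonneg_right (hK ω.1).1.le (pow_nonneg hρ0 j)

lemma integrable_log_pathProd_stopLevel [IsFiniteMeasure ν] (hP : ∀ i j, 0 ≤ P i j)
    (hρ : ∀ i j, P i j ≤ ρ) (hρ1 : ρ < 1) (hε : 0 < ε) :
    Integrable (fun ω : InfWord P => Real.log (pathProd c ω.1 (stopLevel P ε ω.1))) ν :=
  (measurable_integrable_stopped hP hρ hρ1 hε ν (f := fun k x => Real.log (pathProd c x k))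
    fun k x y hxy => by rw [pathProd_congr hxy]).2

lemma IsCylinderSystem.log_pathProd_nonpos (hJ : IsCylinderSystem P c J) (ω : InfWord P) (k : ℕ) :
    Real.log (pathProd c ω.1 k) ≤ 0 :=
  Real.log_nonpos (hJ.pathProd_pos ω k).le
    (Finset.prod_le_one (fun h _ => (hJ.ratio_mem _ _ (ω.2 h)).1.le)
      fun h _ => (hJ.ratio_mem _ _ (ω.2 h)).2.le)

variable [NormedSpace ℝ V] [FiniteDimensional ℝ V] [MeasurableSpace V] [BorelSpace V]
  {d : Seminorm ℝ V}

/-- The stopped net realizes a logarithmic integral comparable to the mean logarithmic size of the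
stopped cylinders. -/
lemma IsChainLaw.exists_logIntegral_le [Nontrivial V] (hν : IsChainLaw P i ν)
    (hJ : IsCylinderSystem P c J) (hP : ∀ i j, 0 ≤ P i j) (hρ : ∀ i j, P i j ≤ ρ) (hρ1 : ρ < 1)
    (hε : 0 < ε) (hε1 : ε ≤ 1) (hδ0 : 0 < δ) (hδ : ∀ i j, 0 < P i j → δ ≤ P i j) {B D : ℝ}
    (hB0 : 0 < B) (hB : ∀ x, d x ≤ B * ‖x‖) (hD : ∀ j, Metric.diam (J [j]) ≤ D) :
    ∃ α : Finset V, 1 ≤ α.card ∧ α.card * (ε * δ) ≤ 1 ∧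
      logIntegral d (ν.map (codingMap P J)) α ≤ ((2 * |Real.log (B * D)| +
        ∫ ω : InfWord P, Real.log (pathProd c ω.1 (stopLevel P ε ω.1)) ∂ν : ℝ) : EReal) := by
  have := hν.isProb
  obtain ⟨α, hα1, hαc, hα⟩ := hν.exists_stopped_net hJ hP hρ hρ1 hε hε1 hδ0 hδ
  have hD0 : 0 < D := (hJ.diam_pos i).trans_le (hD i)
  refine ⟨α, hα1, hαc, logIntegral_map_le d ν hJ.measurable_codingMap α
    (integrable_log_pathProd_stopLevel hP hρ hρ1 hε)
    (fun ω => hJ.log_pathProd_nonpos ω _) (abs_nonneg _) ?_⟩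
  filter_upwards [hα] with ω ⟨a, ha, hdist⟩
  refine (iInf₂_le a ha).trans (ENNReal.ofReal_le_ofReal ?_)
  have hc := hJ.pathProd_pos ω (stopLevel P ε ω.1)
  rw [Real.exp_add, Real.exp_log hc]
  rw [dist_eq_norm, hJ.diam_levelSet] at hdist
  calc d (codingMap P J ω - a) ≤ B * ‖codingMap P J ω - a‖ := hB _
    _ ≤ B * (pathProd c ω.1 (stopLevel P ε ω.1) * D) := by
        refine mul_le_mul_of_nonneg_left (hdist.trans ?_) hB0.le
        exact mul_le_mul_of_nonneg_left (hD _) hc.le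
    _ = B * D * pathProd c ω.1 (stopLevel P ε ω.1) := by ring
    _ = Real.exp (Real.log (B * D)) * pathProd c ω.1 (stopLevel P ε ω.1) := by
        rw [Real.exp_log (mul_pos hB0 hD0)]
    _ ≤ _ := mul_le_mul_of_nonneg_right (Real.exp_le_exp.2 (le_abs_self _)) hc.le

/-- Each of the points of `α` captures at most one cylinder of probability `ε ρ ^ j` at every depth
`j` below the stopping level, so `n ≤ ε⁻¹` points gain only a bounded amount over the mean
logarithmic size of the stopped cylinders. -/
lemma IsChainLaw.le_logIntegral (hν : IsChainLaw P i ν) (hJ : IsCylinderSystem P c J)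
    (hP : ∀ i j, 0 ≤ P i j) (hρ : ∀ i j, P i j ≤ ρ) (hρ0 : 0 ≤ ρ) (hρ1 : ρ < 1) (hε : 0 < ε)
    {t : ℝ} (ht : 0 < t)
    (hsep : ∀ σ j₁ j₂, j₁ ≠ j₂ → IsWord P (σ ++ [j₁]) → IsWord P (σ ++ [j₂]) →
      ∀ x ∈ J (σ ++ [j₁]), ∀ y ∈ J (σ ++ [j₂]),
        t * max (Metric.diam (J (σ ++ [j₁]))) (Metric.diam (J (σ ++ [j₂]))) ≤ dist x y)
    {A D r : ℝ} (hA0 : 0 < A) (hA : ∀ x, A * ‖x‖ ≤ d x) (hD0 : 0 < D)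
    (hD : ∀ j, D ≤ Metric.diam (J [j])) (hr0 : 0 < r) (hr1 : r < 1)
    (hr : ∀ i j, 0 < P i j → r ≤ c i j) {α : Finset V} (hα : α.card * ε ≤ 1) :
    ((-(|Real.log (A * (t / 2) * D)| + -Real.log r / (1 - ρ) -
      ∫ ω : InfWord P, Real.log (pathProd c ω.1 (stopLevel P ε ω.1)) ∂ν) : ℝ) : EReal) ≤
        logIntegral d (ν.map (codingMap P J)) α := by
  have := hν.isProb
  let T : InfWord P → ℕ := fun ω => stopLevel P ε ω.1
  set κ := A * (t / 2) * D with hκ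
  have hκ0 : 0 < κ := by positivity
  set L := -Real.log r with hL
  have hL0 : 0 < L := neg_pos.2 (Real.log_neg hr0 hr1)
  have hint : Integrable (fun ω : InfWord P => |Real.log κ| - Real.log (pathProd c ω.1 (T ω))) ν :=
    (integrable_const _).sub (integrable_log_pathProd_stopLevel hP hρ hρ1 hε)
  have hnonneg : ∀ ω : InfWord P, 0 ≤ |Real.log κ| - Real.log (pathProd c ω.1 (T ω)) := fun ω =>
    sub_nonneg.2 ((hJ.log_pathProd_nonpos ω _).trans (abs_nonneg _))
  have hE : ∫ ω : InfWord P, (|Real.log κ| - Real.log (pathProd c ω.1 (T ω))) ∂ν =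
      |Real.log κ| - ∫ ω : InfWord P, Real.log (pathProd c ω.1 (T ω)) ∂ν := by
    rw [integral_sub (integrable_const _) (integrable_log_pathProd_stopLevel hP hρ hρ1 hε)]
    simp [T]
  have hE0 : 0 ≤ |Real.log κ| - ∫ ω : InfWord P, Real.log (pathProd c ω.1 (T ω)) ∂ν := by
    rw [← hE]
    exact integral_nonneg hnonneg
  have hρ' : 0 < 1 - ρ := by linarith
  choose C hCm hCν hC using fun (a : V) (j : ℕ) =>
    hν.exists_small_cylinder hJ hP hρ hρ0 hρ1 hε ht.le hsep a j
  -- The radii: half the separation distance at level `T + j`, measured in the metric `d`.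
  let R : InfWord P → ℕ → ℝ := fun ω j => κ * pathProd c ω.1 (T ω + j)
  have hR0 : ∀ ω j, 0 < R ω j := fun ω j => mul_pos hκ0 (hJ.pathProd_pos ω _)
  have hclose : ∀ ω : InfWord P, ω.1 0 = i → ∀ j,
      {j | distToSet d (codingMap P J ω) α < ENNReal.ofReal (R ω j)}.indicator
        (fun _ => ENNReal.ofReal L) j ≤
          ∑ a ∈ α, (C a j).indicator (fun _ => ENNReal.ofReal L) ω := by
    intro ω hω j
    rw [Set.indicator_apply]
    split_ifs with hj
    swap
    · exact zero_le
    obtain ⟨a, ha⟩ := iInf_lt_iff.1 (show _ < ENNReal.ofReal (R ω j) from hj)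
    obtain ⟨haα, ha⟩ := iInf_lt_iff.1 ha
    have hd := (ENNReal.ofReal_lt_ofReal_iff (hR0 ω j)).1 ha
    have hmem : ω ∈ C a j := by
      refine hC a j ω hω ?_
      rw [dist_eq_norm, hJ.diam_levelSet]
      refine lt_of_mul_lt_mul_left (((hA _).trans_lt hd).trans_le ?_) hA0.le
      calc R ω j = A * (t / 2 * (pathProd c ω.1 (T ω + j) * D)) := by simp only [R, hκ]; ring
        _ ≤ _ := by
          have := (hJ.pathProd_pos ω (T ω + j)).le
          have := hD (ω.1 (T ω + j))
          gcongr
    refine le_trans (le_of_eq ?_) (Finset.single_le_sum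
      (f := fun a => (C a j).indicator (fun _ => ENNReal.ofReal L) ω) (fun _ _ => zero_le) haα)
    rw [Set.indicator_of_mem hmem]
  have hpoint : ∀ᵐ ω ∂ν, (-ENNReal.log (distToSet d (codingMap P J ω) α)).toENNReal ≤
      ENNReal.ofReal (|Real.log κ| - Real.log (pathProd c ω.1 (T ω))) +
        ∑' j, ∑ a ∈ α, (C a j).indicator (fun _ => ENNReal.ofReal L) ω := by
    filter_upwards [hν.ae_first] with ω hω
    refine (toENNReal_neg_log_le_tsum hL0 (hR0 ω) fun j => ?_).trans
      (add_le_add (ENNReal.ofReal_le_ofReal ?_) (ENNReal.tsum_le_tsum (hclose ω hω)))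
    · have hstep := ω.2 (T ω + j)
      have h1 : R ω (j + 1) = R ω j * c (ω.1 (T ω + j)) (ω.1 (T ω + j + 1)) := by
        simp only [R]
        rw [← add_assoc, pathProd_succ]
        ring
      rw [h1, Real.log_mul (hR0 ω j).ne' (hJ.ratio_mem _ _ hstep).1.ne', hL]
      linarith [Real.log_le_log hr0 (hr _ _ hstep)]
    · simp only [R, add_zero]
      rw [Real.log_mul hκ0.ne' (hJ.pathProd_pos ω _).ne']
      linarith [neg_abs_le (Real.log κ)]
  have hcount : ∀ j, ∑ a ∈ α, ENNReal.ofReal L * ν (C a j) ≤ ENNReal.ofReal (L * ρ ^ j) := by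
    intro j
    calc ∑ a ∈ α, ENNReal.ofReal L * ν (C a j)
        ≤ ∑ _a ∈ α, ENNReal.ofReal L * ENNReal.ofReal (ε * ρ ^ j) :=
          Finset.sum_le_sum fun a _ => mul_le_mul_right (hCν a j) _
      _ = ENNReal.ofReal (α.card * (L * (ε * ρ ^ j))) := by
          rw [Finset.sum_const, nsmul_eq_mul, ← ENNReal.ofReal_mul hL0.le,
            ENNReal.ofReal_mul (Nat.cast_nonneg _), ENNReal.ofReal_natCast]
      _ ≤ ENNReal.ofReal (L * ρ ^ j) := by
          refine ENNReal.ofReal_le_ofReal ?_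
          have h1 : 0 ≤ L * ρ ^ j := by positivity
          nlinarith
  have htail : ∫⁻ ω, ∑' j, ∑ a ∈ α, (C a j).indicator (fun _ => ENNReal.ofReal L) ω ∂ν ≤
      ENNReal.ofReal (L / (1 - ρ)) := by
    have hmeas : ∀ a j, Measurable ((C a j).indicator fun _ => ENNReal.ofReal L) := fun a j =>
      measurable_const.indicator (hCm a j)
    rw [lintegral_tsum fun j => (Finset.measurable_sum _ fun a _ => hmeas a j).aemeasurable]
    have hgeom := (summable_geometric_of_lt_one hρ0 hρ1).mul_left L
    calc ∑' j, ∫⁻ ω, ∑ a ∈ α, (C a j).indicator (fun _ => ENNReal.ofReal L) ω ∂ν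
        = ∑' j, ∑ a ∈ α, ENNReal.ofReal L * ν (C a j) := by
          congr 1
          funext j
          rw [lintegral_finsetSum _ fun a _ => hmeas a j]
          exact Finset.sum_congr rfl fun a _ => lintegral_indicator_const (hCm a j) _
      _ ≤ ∑' j, ENNReal.ofReal (L * ρ ^ j) := ENNReal.tsum_le_tsum hcount
      _ = ENNReal.ofReal (L / (1 - ρ)) := by
          rw [← ENNReal.ofReal_tsum_of_nonneg (fun j => by positivity) hgeom, tsum_mul_left,
            tsum_geometric_of_lt_one hρ0 hρ1, div_eq_mul_inv]
  have hmap : ∫⁻ x, (-ENNReal.log (distToSet d x α)).toENNReal ∂(ν.map (codingMap P J)) =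
      ∫⁻ ω, (-ENNReal.log (distToSet d (codingMap P J ω) α)).toENNReal ∂ν := by
    have h1 : Measurable fun x => -ENNReal.log (distToSet d x α) :=
      (measurable_distToSet d α).ennreal_log.neg
    exact lintegral_map h1.ereal_toENNReal hJ.measurable_codingMap
  refine neg_le_logIntegral d _ α (by
    have : 0 ≤ L / (1 - ρ) := by positivity
    linarith) ?_
  rw [hmap]
  calc ∫⁻ ω, (-ENNReal.log (distToSet d (codingMap P J ω) α)).toENNReal ∂ν
      ≤ ∫⁻ ω, (ENNReal.ofReal (|Real.log κ| - Real.log (pathProd c ω.1 (T ω))) +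
        ∑' j, ∑ a ∈ α, (C a j).indicator (fun _ => ENNReal.ofReal L) ω) ∂ν :=
        lintegral_mono_ae hpoint
    _ = ENNReal.ofReal (|Real.log κ| - ∫ ω : InfWord P, Real.log (pathProd c ω.1 (T ω)) ∂ν) +
        ∫⁻ ω, ∑' j, ∑ a ∈ α, (C a j).indicator (fun _ => ENNReal.ofReal L) ω ∂ν := by
        rw [lintegral_add_left' hint.aestronglyMeasurable.aemeasurable.ennreal_ofReal, ← hE,
          ofReal_integral_eq_lintegral_ofReal hint (Eventually.of_forall hnonneg)]
    _ ≤ _ := by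
        refine (add_le_add_right htail _).trans (le_of_eq ?_)
        rw [← ENNReal.ofReal_add hE0 (by positivity)]
        congr 1
        ring

end Estimates

end GeometricQuantization

theorem proposition3
    {V : Type*} [NormedAddCommGroup V] [NormedSpace ℝ V] [FiniteDimensional ℝ V] [Nontrivial V]
    [MeasurableSpace V] [BorelSpace V]
    (d : Seminorm ℝ V) (hd : ∀ x, d x = 0 → x = 0)
    {N : ℕ} (P c : Matrix (Fin N) (Fin N) ℝ)
    (hP : P ∈ Matrix.rowStochastic ℝ (Fin N)) (hirr : P.IsIrreducible)
    (hcard : ∀ i, 2 ≤ (Finset.univ.filter fun j => 0 < P i j).card)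
    (J : List (Fin N) → Set V)
    (hJ : GeometricQuantization.IsCylinderSystem P c J)
    (hsep : GeometricQuantization.IsSeparated P J)
    (q : Fin N → ℝ) (hq : ∀ i, 0 < q i) (hq1 : ∑ i, q i = 1)
    (m : Measure (GeometricQuantization.InfWord P))
    (hm : GeometricQuantization.IsMarkovMeasure P q m)
    (μ : Measure V) (hμ : μ = m.map (GeometricQuantization.codingMap P J))
    (v : Fin N → ℝ) (hv : GeometricQuantization.IsPerronVector P v)
    (i : Fin N) :
    0 < GeometricQuantization.exponent P c v ∧
    0 < GeometricQuantization.lowerQuantCoeff d (GeometricQuantization.exponent P c v)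
        (ProbabilityTheory.cond μ (J [i])) ∧
    GeometricQuantization.lowerQuantCoeff d (GeometricQuantization.exponent P c v)
        (ProbabilityTheory.cond μ (J [i])) ≤
      GeometricQuantization.upperQuantCoeff d (GeometricQuantization.exponent P c v)
        (ProbabilityTheory.cond μ (J [i])) ∧
    GeometricQuantization.upperQuantCoeff d (GeometricQuantization.exponent P c v)
        (ProbabilityTheory.cond μ (J [i])) < ∞ := by
  open GeometricQuantization in
  have hs := exponent_pos hP hcard hJ.ratio_mem hv
  refine ⟨hs, ?_⟩
  obtain ⟨h, hh⟩ := exists_martingale_corrector hP hirr hcard hJ.ratio_mem hv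
  set s := exponent P c v
  have hP0 : ∀ i j, 0 ≤ P i j := fun i j => Matrix.nonneg_of_mem_rowStochastic hP
  have hν := hm.isChainLaw hP0 hq i
  rw [hμ, cond_map_codingMap hJ hsep]
  set ν := ProbabilityTheory.cond m {ω | ω.1 0 = i}
  obtain ⟨A, B, hA0, hB0, hAB⟩ := exists_seminorm_bounds d hd
  obtain ⟨ρ, hρ0, hρ1, hρ⟩ := exists_lt_one_forall_le (p := fun _ : Fin N × Fin N => True)
    (f := fun e => P e.1 e.2) fun e _ => lt_one_of_two_le_card hP hcard _ _
  obtain ⟨δ, hδ0, -, hδ⟩ := exists_pos_forall_le (p := fun e : Fin N × Fin N => 0 < P e.1 e.2)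
    (f := fun e => P e.1 e.2) fun e he => he
  obtain ⟨r, hr0, hr1, hr⟩ := exists_pos_forall_le (p := fun e : Fin N × Fin N => 0 < P e.1 e.2)
    (f := fun e => c e.1 e.2) fun e he => (hJ.ratio_mem _ _ he).1
  obtain ⟨D, hD0, -, hD⟩ := exists_pos_forall_le (p := fun _ : Fin N => True)
    (f := fun j => Metric.diam (J [j])) fun j _ => hJ.diam_pos j
  obtain ⟨t, ht0, -, hsep⟩ := hsep
  have hD' : ∀ j, Metric.diam (J [j]) ≤ ∑ j, Metric.diam (J [j]) := fun j =>
    Finset.single_le_sum (f := fun j => Metric.diam (J [j]))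
      (fun _ _ => Metric.diam_nonneg) (Finset.mem_univ j)
  have hH : ∀ j, |h j| ≤ ∑ j, |h j| := fun j =>
    Finset.single_le_sum (f := fun j => |h j|) (fun _ _ => abs_nonneg _) (Finset.mem_univ j)
  set H := ∑ j, |h j|
  set D' := ∑ j, Metric.diam (J [j])
  have hρ' : ∀ i j, P i j ≤ ρ := fun i j => hρ (i, j) trivial
  have hδ' : ∀ i j, 0 < P i j → δ ≤ P i j := fun i j => hδ (i, j)
  have hbounds := fun (ε : ℝ) (hε : 0 < ε) (hε1 : ε ≤ 1) =>
    hν.integral_log_pathProd_bounds hP0 hρ' hρ1 hε hε1 hδ0 hδ'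
      (fun i j hij => (hJ.ratio_mem i j hij).1) hh hH
  refine quantCoeff_bounds d _
    (B := |Real.log (A * (t / 2) * D)| + -Real.log r / (1 - ρ) +
      1 / s * (2 * H - Real.log δ))
    (C := 2 * |Real.log (B * D')| + 1 / s * (2 * H - Real.log δ)) (fun n hn α _ hαn => ?_) ?_
  · -- The lower estimate, with stopping threshold `ε = n⁻¹`.
    have hn0 : (0 : ℝ) < n := by exact_mod_cast hn
    have hn1 : (1 : ℝ) ≤ n := by exact_mod_cast hn
    have hε : (0 : ℝ) < (n : ℝ)⁻¹ := inv_pos.2 hn0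
    have hα : (α.card : ℝ) * (n : ℝ)⁻¹ ≤ 1 := by
      rw [mul_inv_le_iff₀ hn0, one_mul]
      exact_mod_cast hαn
    refine le_trans (EReal.coe_le_coe_iff.2 ?_) (hν.le_logIntegral hJ hP0 hρ' hρ0.le hρ1 hε ht0
      hsep hA0 (fun x => (hAB x).1) hD0 (fun j => hD j trivial) hr0 hr1
      (fun i j => hr (i, j)) hα)
    have h1 := (hbounds _ hε (inv_le_one_of_one_le₀ hn1)).1
    rw [Real.log_mul hε.ne' hδ0.ne', Real.log_inv] at h1
    have h2 := mul_le_mul_of_nonneg_left h1 (one_div_pos.2 hs).le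
    rw [← mul_assoc, one_div_mul_cancel hs.ne', one_mul] at h2
    linarith
  · -- The upper estimate: `ε = (n δ)⁻¹` leaves at most `n` stopped cylinders.
    filter_upwards [eventually_ge_atTop 1, tendsto_natCast_atTop_atTop.eventually_ge_atTop δ⁻¹]
      with n hn hnδ
    have hn0 : (0 : ℝ) < n := by exact_mod_cast hn
    have hnδ1 : 1 ≤ n * δ := by rwa [inv_le_iff_one_le_mul₀ hδ0] at hnδ
    have hε : 0 < ((n : ℝ) * δ)⁻¹ := by positivity
    have hε1 : ((n : ℝ) * δ)⁻¹ ≤ 1 := inv_le_one_of_one_le₀ hnδ1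
    obtain ⟨α, hα1, hαc, hα⟩ := hν.exists_logIntegral_le hJ hP0 hρ' hρ1 hε hε1 hδ0 hδ' hB0
      (fun x => (hAB x).2) hD'
    refine ⟨α, hα1, ?_, hα.trans (EReal.coe_le_coe_iff.2 ?_)⟩
    · have h1 : ((n : ℝ) * δ)⁻¹ * δ = (n : ℝ)⁻¹ := by field_simp
      rw [h1, mul_inv_le_iff₀ hn0, one_mul] at hαc
      exact_mod_cast hαc
    · have h1 := (hbounds _ hε hε1).2
      rw [Real.log_inv, Real.log_mul hn0.ne' hδ0.ne'] at h1
      have h2 := mul_le_mul_of_nonneg_left h1 (one_div_pos.2 hs).le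
      rw [← mul_assoc, one_div_mul_cancel hs.ne', one_mul] at h2
      linarith
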